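/- For $r>0$ and a positive sequence $M=(M_n)_{n\ge0}$, let $\mathcal C_M([-r,r])$ be the Denjoy--Carleman class of all real-valued $\psi\in C^\infty([-r,r])$ for which there is a constant $K>0$ with $\sup_{|t|\le r}|\psi^{(n)}(t)|\le K^{n+1}M_n$ for all $n\ge0$. For a phase $\psi$ on $[-r,r]$ and $\lambda\in\mathbb R$ put $$m_{r,\psi}(\lambda)=\mathrm{p.v.}\int_{-r}^{r}e^{i\lambda\psi(t)}\,\frac{dt}{t}=\lim_{\varepsilon\to0^+}\int_{\varepsilon\le|t|\le r}e^{i\lambda\psi(t)}\,\frac{dt}{t}.$$ Let $\alpha>1$. (i) Let $c>0$ and $M_n=\exp(cn^\alpha)$. For every $\psi\in\mathcal C_M([-1,1])$ the principal value $m_{1,\psi}(\lambda)$ exists for all real $\lambda$, and $m_{1,\psi}(\lambda)=O\big((\log\lambda)^{1-1/\alpha}\big)$ as $\lambda\to\infty$ (the implied constant may depend on $\psi$). (ii) This is sharp: for every $c>0$ there is a real-valued $\psi\in\mathcal C_M([-1,1])$, $M_n=\exp(cn^\alpha)$, and a sequence $\lambda_n\to\infty$ such that $|m_{1,\psi}(\lambda_n)|\approx(\log\lambda_n)^{1-1/\alpha}$,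 that is, for all large $n$ the two sides are bounded by constant multiples of each other, with positive constants independent of $n$. (iii) Explicitly, the phase given by $\psi(t)=0$ for $t\le0$ and $\psi(t)=\exp\big(-(\log\frac1t)^{\alpha/(\alpha-1)}\big)$ for $0<t\le 1/e$ belongs to $\mathcal C_M([-1/e,1/e])$ with $M_n=\exp(cn^\alpha)$ for some $c>0$; the principal value $m_{1/e,\psi}(\lambda)$ exists for all real $\lambda$, and $|m_{1/e,\psi}(\lambda_n)|\approx(\log\lambda_n)^{1-1/\alpha}$ along a sequence $\lambda_n\to\infty$. -/

import Mathlib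

open Filter Topology Asymptotics
open scoped ContDiff

noncomputable section

namespace SteinWainger

/-- The integral of `e^{iλψ(t)} / t` over `ε ≤ |t| ≤ r` (used for `0 < ε < r`). -/
def truncated (r : ℝ) (ψ : ℝ → ℝ) (lam ε : ℝ) : ℂ :=
  (∫ t in (-r)..(-ε), Complex.exp (Complex.I * (lam * ψ t : ℝ)) / (t : ℂ)) +
    ∫ t in ε..r, Complex.exp (Complex.I * (lam * ψ t : ℝ)) / (t : ℂ)

/-- The principal value `p.v. ∫_{-r}^{r} e^{iλψ(t)} dt/t` exists and equals `z`. -/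
def HasPV (r : ℝ) (ψ : ℝ → ℝ) (lam : ℝ) (z : ℂ) : Prop :=
  Tendsto (truncated r ψ lam) (𝓝[>] 0) (𝓝 z)

/-- The oscillatory integral `m(λ) = p.v. ∫_{-r}^{r} e^{iλψ(t)} dt/t`. It is meaningful when the
principal value exists, which is always asserted separately through `HasPV`. -/
def m (r : ℝ) (ψ : ℝ → ℝ) (lam : ℝ) : ℂ :=
  limUnder (𝓝[>] (0 : ℝ)) (truncated r ψ lam)

/-- The Denjoy–Carleman class `C_M([-r, r])` of real-valued functions; derivatives at the end
points are one-sided. Only the values of `ψ` on `[-r, r]` matter. -/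
def MemDenjoyCarleman (M : ℕ → ℝ) (r : ℝ) (ψ : ℝ → ℝ) : Prop :=
  ContDiffOn ℝ ∞ ψ (Set.Icc (-r) r) ∧
    ∃ K : ℝ, 0 < K ∧ ∀ n : ℕ, ∀ t ∈ Set.Icc (-r) r,
      |iteratedDerivWithin n ψ (Set.Icc (-r) r) t| ≤ K ^ (n + 1) * M n

/-- The weight sequence `M_n = exp(c n^α)`. -/
def weight (c α : ℝ) (n : ℕ) : ℝ := Real.exp (c * (n : ℝ) ^ α)

/-- The phase equal to `0` for `t ≤ 0` and to `exp(-(log(1/t))^{α/(α-1)})` for `t > 0`;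
it is only considered for `t ≤ 1/e`. -/
def sharpPhase (α : ℝ) (t : ℝ) : ℝ :=
  if t ≤ 0 then 0 else Real.exp (-((Real.log (1 / t)) ^ (α / (α - 1))))

/-- `|m(λ_n)| ≈ (log λ_n)^{1-1/α}` along some sequence `λ_n → ∞`. -/
def AttainsGrowth (α r : ℝ) (ψ : ℝ → ℝ) : Prop :=
  ∃ lam : ℕ → ℝ, Tendsto lam atTop atTop ∧
    (fun n => ‖m r ψ (lam n)‖) =Θ[atTop] (fun n => (Real.log (lam n)) ^ (1 - 1 / α))

end SteinWainger

end

/-! Upper bound. Write `L = log λ` and take `n` of size `L^{1/α}`. With `e^D = λ K^{n+1} M_n` and `δ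
= e^{-D/n}`, Taylor's formula of order `n` gives `λ|ψ(t) - P(t)| ≤ (|t|/δ)^n`, so on `|t| ≤ δ`
replacing `ψ` by a polynomial of degree at most `n` costs `O(1)`. The range `δ ≤ |t| ≤ 1` costs at
most `2 log(1/δ) = 2D/n`. Since `D/n` is `L/n + c n^{α-1}` up to bounded terms, this choice of `n`
makes it `O(L^{1-1/α})`; see `norm_oddOsc_le_of_iteratedDerivWithin_le`.

What remains is a bound `O(log n)` for polynomial phases of degree `n`, uniform in the coefficients
(`norm_oddOsc_polynomial_le`); it is negligible because `log n = O(n^{α-1})`. Each doubling of the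
degree costs a constant. Choose `ρ` so that the largest upper-half term `|c_j| ρ^j` equals 1. Below
`ρ` the upper half of the coefficients can be dropped. Beyond `ρ`,
`norm_integral_polynomial_phase_le` integrates by parts with `q/(q² + a²)`, `q = tP'`, `a = deg P`.
The remainder `∫ a²/(q² + a²) dt/t` is controlled by factoring `q` over `ℂ` and applying the
inequality of geometric and arithmetic means to the roots, which removes any dependence on the
degree.

Sharpness. For the phase `exp(-A(b - log t)^β)` on `t > 0`, with `β` conjugate to `α`, the
substitution `t = e^{b-u}` turns the integral into `∫_1^∞ (exp(iλe^{-Au^β}) - 1) du`. If `λ = exp(A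
U^β)`, the integrand is small beyond `U`, while before `U` the exponential oscillates and the `-1`
survives, giving `1 - U + O(1)` with `U = (log λ / A)^{1-1/α}`. Membership in the class follows from
Cauchy estimates on discs of radius comparable to `t`; Young's inequality converts `t^{-n}` times
the flat factor into `exp(const · n^α)`. -/

noncomputable section

namespace SteinWainger

open MeasureTheory

section PolynomialPhase

open Polynomial

/-! ### A uniformly integrable kernel -/

/-- An integrable majorant of `|s|^{-1/2}` near `0` that decays like `|s|^{-5/4}` at infinity. -/
def kernelMajorant (s : ℝ) : ℝ :=
  (Set.Icc (-1 : ℝ) 1).indicator (fun s => |s| ^ (-(1 / 2) : ℝ)) s + 4 * (1 + ‖s‖) ^ (-(5 / 4) : ℝ)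

theorem kernelMajorant_nonneg (s : ℝ) : 0 ≤ kernelMajorant s := by
  unfold kernelMajorant
  refine add_nonneg (Set.indicator_nonneg (fun x _ => by positivity) _) (by positivity)

theorem integrable_kernelMajorant : Integrable kernelMajorant := by
  refine Integrable.add ?_ ((integrable_one_add_norm (μ := (volume : Measure ℝ)) ?_).const_mul 4)
  · rw [integrable_indicator_iff measurableSet_Icc, integrableOn_Icc_iff_integrableOn_Ioc,
      ← intervalIntegrable_iff_integrableOn_Ioc_of_le (by norm_num)]
    have h1 : IntervalIntegrable (fun s : ℝ => |s| ^ (-(1 / 2) : ℝ)) volume 0 1 := by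
      refine (intervalIntegral.intervalIntegrable_rpow' (a := 0) (b := 1)
        (r := -(1 / 2)) (by norm_num)).congr ?_
      intro x hx
      rw [Set.uIoc_of_le zero_le_one] at hx
      simp only [abs_of_pos hx.1]
    have h2 := h1.comp_sub_left 0
    simp only [zero_sub, abs_neg, neg_zero] at h2
    exact h2.symm.trans h1
  · simp; norm_num

/-- For `|t - r| ≤ 1` the first factor is at most 1. Otherwise replacing the larger of `t`, `|t -
r|` by the smaller merges the exponents into `-5/4`. -/
theorem rpow_mul_inv_sqrt_le {t : ℝ} (ht : 1 ≤ t) {r : ℝ} (hr : t ≠ r) :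
    t ^ (-(3 / 4) : ℝ) * |t - r| ^ (-(1 / 2) : ℝ) ≤ t ^ (-(5 / 4) : ℝ) + kernelMajorant (t - r) := by
  have ht0 : 0 < t := by linarith
  have hs : 0 < |t - r| := abs_pos.2 (sub_ne_zero.2 hr)
  have h5 : 0 < t ^ (-(5 / 4) : ℝ) := by positivity
  rcases le_total |t - r| 1 with h | h
  · have h1 : t ^ (-(3 / 4) : ℝ) ≤ 1 := Real.rpow_le_one_of_one_le_of_nonpos ht (by norm_num)
    have h2 : |t - r| ^ (-(1 / 2) : ℝ) ≤ kernelMajorant (t - r) := by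
      unfold kernelMajorant
      rw [Set.indicator_of_mem (by rwa [Set.mem_Icc, ← abs_le])]
      have : 0 ≤ 4 * (1 + ‖t - r‖) ^ (-(5 / 4) : ℝ) := by positivity
      linarith
    have h3 : 0 ≤ |t - r| ^ (-(1 / 2) : ℝ) := by positivity
    nlinarith
  · have h2 : |t - r| ^ (-(5 / 4) : ℝ) ≤ kernelMajorant (t - r) := by
      unfold kernelMajorant
      have h0 : 0 ≤ (Set.Icc (-1 : ℝ) 1).indicator (fun s => |s| ^ (-(1 / 2) : ℝ)) (t - r) :=
        Set.indicator_nonneg (fun x _ => by positivity) _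
      have h3 : (2 * |t - r|) ^ (-(5 / 4) : ℝ) ≤ (1 + |t - r|) ^ (-(5 / 4) : ℝ) :=
        Real.rpow_le_rpow_of_nonpos (by positivity) (by linarith) (by norm_num)
      rw [Real.mul_rpow (by norm_num) hs.le] at h3
      have h4 : (4 : ℝ)⁻¹ ≤ 2 ^ (-(5 / 4) : ℝ) := by
        have : (4 : ℝ)⁻¹ = 2 ^ (-2 : ℝ) := by
          rw [Real.rpow_neg (by norm_num)]; norm_num
        rw [this]
        exact Real.rpow_le_rpow_of_exponent_le (by norm_num) (by norm_num)
      have h6 : 0 < |t - r| ^ (-(5 / 4) : ℝ) := by positivity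
      rw [Real.norm_eq_abs]
      nlinarith
    rcases le_total t |t - r| with h' | h'
    · have : |t - r| ^ (-(1 / 2) : ℝ) ≤ t ^ (-(1 / 2) : ℝ) :=
        Real.rpow_le_rpow_of_nonpos ht0 h' (by norm_num)
      have e : t ^ (-(5 / 4) : ℝ) = t ^ (-(3 / 4) : ℝ) * t ^ (-(1 / 2) : ℝ) := by
        rw [← Real.rpow_add ht0]; norm_num
      have := mul_le_mul_of_nonneg_left this (by positivity : 0 ≤ t ^ (-(3 / 4) : ℝ))
      linarith [kernelMajorant_nonneg (t - r)]
    · have : t ^ (-(3 / 4) : ℝ) ≤ |t - r| ^ (-(3 / 4) : ℝ) :=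
        Real.rpow_le_rpow_of_nonpos hs h' (by norm_num)
      have e : |t - r| ^ (-(5 / 4) : ℝ) = |t - r| ^ (-(3 / 4) : ℝ) * |t - r| ^ (-(1 / 2) : ℝ) := by
        rw [← Real.rpow_add hs]; norm_num
      have := mul_le_mul_of_nonneg_right this (by positivity : 0 ≤ |t - r| ^ (-(1 / 2) : ℝ))
      linarith

/-- The contribution of a single root of modulus `r`. The right side has an integral over `t ≥ 1`
bounded independently of `r`, by translation invariance. -/
theorem rpow_mul_sqrt_div_le {t : ℝ} (ht : 1 ≤ t) {r : ℝ} (hr : t ≠ r) :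
    t ^ (-(5 / 4) : ℝ) * √((t + r) / |t - r|) ≤
      3 * t ^ (-(5 / 4) : ℝ) + 2 * kernelMajorant (t - r) := by
  have ht0 : 0 < t := by linarith
  have hs : 0 < |t - r| := abs_pos.2 (sub_ne_zero.2 hr)
  have h1 : √((t + r) / |t - r|) ≤ 1 + 2 * (t ^ (1 / 2 : ℝ) * |t - r| ^ (-(1 / 2) : ℝ)) := by
    have h2 : (t + r) / |t - r| ≤ 1 + 2 * t / |t - r| := by
      rw [div_le_iff₀ hs, add_mul, div_mul_cancel₀ _ hs.ne']
      rcases abs_cases (t - r) with h | h <;> linarith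
    have h3 : t ^ (1 / 2 : ℝ) * |t - r| ^ (-(1 / 2) : ℝ) = √(t / |t - r|) := by
      rw [Real.rpow_neg hs.le, ← Real.sqrt_eq_rpow, ← Real.sqrt_eq_rpow, Real.sqrt_div ht0.le]
      rfl
    rw [h3]
    refine Real.sqrt_le_iff.2 ⟨by positivity, h2.trans ?_⟩
    have := Real.sq_sqrt (by positivity : 0 ≤ t / |t - r|)
    have e : 2 * t / |t - r| = 2 * √(t / |t - r|) ^ 2 := by rw [this]; ring
    rw [e]
    nlinarith [Real.sqrt_nonneg (t / |t - r|)]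
  have e : t ^ (-(5 / 4) : ℝ) * t ^ (1 / 2 : ℝ) = t ^ (-(3 / 4) : ℝ) := by
    rw [← Real.rpow_add ht0]; norm_num
  calc _ ≤ t ^ (-(5 / 4) : ℝ) * (1 + 2 * (t ^ (1 / 2 : ℝ) * |t - r| ^ (-(1 / 2) : ℝ))) := by gcongr
    _ = t ^ (-(5 / 4) : ℝ) + 2 * (t ^ (-(3 / 4) : ℝ) * |t - r| ^ (-(1 / 2) : ℝ)) := by
      rw [← e]; ring
    _ ≤ _ := by linarith [rpow_mul_inv_sqrt_le ht hr]

/-- The integral of `3 t^{-5/4}` over `(1, ∞)` plus twice that of the majorant over `ℝ`. -/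
def kernelBound : ℝ := 3 * (∫ t in Set.Ioi (1 : ℝ), t ^ (-(5 / 4) : ℝ)) + 2 * ∫ s, kernelMajorant s

theorem kernelBound_nonneg : 0 ≤ kernelBound := by
  unfold kernelBound
  have h1 : 0 ≤ ∫ t in Set.Ioi (1 : ℝ), t ^ (-(5 / 4) : ℝ) :=
    setIntegral_nonneg measurableSet_Ioi fun t ht => Real.rpow_nonneg (zero_le_one.trans ht.le) _
  have h2 : 0 ≤ ∫ s, kernelMajorant s := integral_nonneg kernelMajorant_nonneg
  positivity

theorem intervalIntegrable_kernel {a b : ℝ} (ha : 1 ≤ a) (hab : a ≤ b) (r : ℝ) :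
    IntervalIntegrable (fun t => 3 * t ^ (-(5 / 4) : ℝ) + 2 * kernelMajorant (t - r))
      volume a b := by
  refine IntervalIntegrable.add ?_ ?_
  · refine ((intervalIntegrable_iff_integrableOn_Ioc_of_le hab).2 ?_).const_mul 3
    exact (integrableOn_Ioi_rpow_of_lt (by norm_num) zero_lt_one).mono_set
      fun t ht => lt_of_le_of_lt ha ht.1
  · exact ((integrable_kernelMajorant.comp_sub_right r).const_mul 2).intervalIntegrable

theorem integral_kernel_le {a b : ℝ} (ha : 1 ≤ a) (hab : a ≤ b) (r : ℝ) :
    ∫ t in a..b, (3 * t ^ (-(5 / 4) : ℝ) + 2 * kernelMajorant (t - r)) ≤ kernelBound := by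
  have i1 : IntegrableOn (fun t : ℝ => t ^ (-(5 / 4) : ℝ)) (Set.Ioi 1) :=
    integrableOn_Ioi_rpow_of_lt (by norm_num) zero_lt_one
  have hs : Set.Ioc a b ⊆ Set.Ioi 1 := fun t ht => lt_of_le_of_lt ha ht.1
  have i2 := integrable_kernelMajorant.comp_sub_right r
  rw [intervalIntegral.integral_of_le hab, integral_add ((i1.mono_set hs).const_mul 3)
    (i2.const_mul 2).integrableOn, integral_const_mul, integral_const_mul]
  unfold kernelBound
  gcongr
  · filter_upwards [ae_restrict_mem measurableSet_Ioi] with t ht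
    exact Real.rpow_nonneg (zero_le_one.trans (le_of_lt ht)) _
  · rw [← integral_sub_right_eq_self (fun s => kernelMajorant s) r]
    exact setIntegral_le_integral i2 (ae_of_all _ fun t => kernelMajorant_nonneg _)

/-! ### Total variation and zeros of the derivative -/

/-- Between consecutive zeros of `f'` the function is monotone and varies by at most `2B`. The
interval is cut at a zero, and `N` serves only as the parameter of the induction on the size of `S`.
-/
theorem integral_abs_deriv_le {f f' : ℝ → ℝ} (hf : ∀ x, HasDerivAt f (f' x) x)
    (hf' : Continuous f') {B : ℝ} (hB : ∀ x, |f x| ≤ B) (N : ℕ) :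
    ∀ (S : Finset ℝ) (a b : ℝ), a ≤ b → S.card ≤ N →
      (∀ x ∈ Set.Ioo a b, f' x = 0 → x ∈ S) → ∫ x in a..b, |f' x| ≤ 2 * B * (S.card + 1) := by
  have hftc : ∀ a b, ∫ x in a..b, f' x = f b - f a := fun a b =>
    intervalIntegral.integral_eq_sub_of_hasDerivAt (fun x _ => hf x) (hf'.intervalIntegrable _ _)
  have hB0 : 0 ≤ B := (abs_nonneg _).trans (hB 0)
  have hdiff : ∀ a b, |f b - f a| ≤ 2 * B := fun a b => by
    have := abs_sub (f b) (f a)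
    linarith [hB a, hB b]
  induction N using Nat.strong_induction_on with
  | _ N ih =>
    intro S a b hab hSN hS
    by_cases hz : ∃ c ∈ Set.Ioo a b, f' c = 0
    · obtain ⟨c, hc, hc0⟩ := hz
      have hcS := hS c hc hc0
      have hcard : (S.filter (· < c)).card + (S.filter (c < ·)).card + 1 ≤ S.card := by
        rw [← Finset.card_union_of_disjoint, ← Finset.card_singleton c,
          ← Finset.card_union_of_disjoint]
        · refine Finset.card_le_card fun x hx => ?_
          simp only [Finset.mem_union, Finset.mem_filter, Finset.mem_singleton] at hx
          rcases hx with (hx | hx) | rfl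
          exacts [hx.1, hx.1, hcS]
        · simp
        · exact Finset.disjoint_filter.2 fun x _ h1 h2 => lt_asymm h1 h2
      have h1 := ih (S.filter (· < c)).card (by omega) (S.filter (· < c)) a c hc.1.le le_rfl
        fun x hx h0 => Finset.mem_filter.2 ⟨hS x ⟨hx.1, hx.2.trans hc.2⟩ h0, hx.2⟩
      have h2 := ih (S.filter (c < ·)).card (by omega) (S.filter (c < ·)) c b hc.2.le le_rfl
        fun x hx h0 => Finset.mem_filter.2 ⟨hS x ⟨hc.1.trans hx.1, hx.2⟩ h0, hx.1⟩
      rw [← intervalIntegral.integral_add_adjacent_intervals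
        (hf'.abs.intervalIntegrable a c) (hf'.abs.intervalIntegrable c b)]
      have hcard' : ((S.filter (· < c)).card : ℝ) + (S.filter (c < ·)).card + 1 ≤ S.card := by
        exact_mod_cast hcard
      nlinarith
    · push Not at hz
      have hsign : (∀ x ∈ Set.Ioo a b, 0 ≤ f' x) ∨ (∀ x ∈ Set.Ioo a b, f' x ≤ 0) := by
        by_contra! hcon
        obtain ⟨⟨x, hx, hx0⟩, y, hy, hy0⟩ := hcon
        have hsub : Set.uIcc x y ⊆ Set.Ioo a b := Set.OrdConnected.uIcc_subset
          Set.ordConnected_Ioo hx hy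
        have : (0 : ℝ) ∈ f' '' Set.uIcc x y :=
          intermediate_value_uIcc hf'.continuousOn
            (by rw [Set.mem_uIcc]; left; exact ⟨hx0.le, hy0.le⟩)
        obtain ⟨c, hc, hc0⟩ := this
        exact hz c (hsub hc) hc0
      have hle : ∫ x in a..b, |f' x| ≤ 2 * B := by
        rcases hsign with h | h
        · have : ∫ x in a..b, |f' x| = ∫ x in a..b, f' x := by
            refine intervalIntegral.integral_congr_Ioo_of_le hab ?_
            intro x hx
            exact abs_of_nonneg (h x hx)
          rw [this, hftc]
          exact (le_abs_self _).trans (hdiff a b)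
        · have : ∫ x in a..b, |f' x| = ∫ x in a..b, -f' x := by
            refine intervalIntegral.integral_congr_Ioo_of_le hab ?_
            intro x hx
            exact abs_of_nonpos (h x hx)
          rw [this, intervalIntegral.integral_neg, hftc]
          exact (neg_le_abs _).trans (hdiff a b)
      have : (0 : ℝ) ≤ S.card := by positivity
      nlinarith

/-! ### Polynomials away from their roots -/

/-- Indexing the roots by `Fin n`, with multiplicity, prepares the means with equal weights `1/n`.
-/
theorem exists_map_eq_prod (q : ℝ[X]) : ∃ (n : ℕ) (z : Fin n → ℂ), n = q.natDegree ∧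
    q.map (algebraMap ℝ ℂ) = C (q.leadingCoeff : ℂ) * ∏ i, (X - C (z i)) := by
  set p := q.map (algebraMap ℝ ℂ) with hp
  have hs := IsAlgClosed.splits p
  refine ⟨p.roots.toList.length, fun i => p.roots.toList[i], ?_, ?_⟩
  · rw [Multiset.length_toList, ← hs.natDegree_eq_card_roots, hp, natDegree_map]
  · have h1 := hs.eq_prod_roots
    have h2 : p.leadingCoeff = (q.leadingCoeff : ℂ) := by
      rw [hp, leadingCoeff_map]; rfl
    have h3 : ∏ i : Fin p.roots.toList.length, (X - C p.roots.toList[i]) =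
        (Multiset.map (fun x => X - C x) p.roots).prod := by
      refine (Fin.prod_univ_fun_getElem p.roots.toList (fun x => X - C x)).trans ?_
      conv_rhs => rw [← Multiset.coe_toList p.roots]
      rw [Multiset.map_coe, Multiset.prod_coe]
    rw [h3, ← h2]
    exact h1

theorem norm_coeff_prod_mul_pow_le {ι : Type*} (s : Finset ι) (z : ι → ℂ) {t : ℝ} (ht : 0 ≤ t)
    (j : ℕ) : ‖(∏ i ∈ s, (X - C (z i))).coeff j‖ * t ^ j ≤ ∏ i ∈ s, (t + ‖z i‖) := by
  classical
  induction s using Finset.induction_on generalizing j with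
  | empty =>
    simp only [Finset.prod_empty, coeff_one]
    split_ifs with h
    · simp [h]
    · simp
  | insert i s hi ih =>
    rw [Finset.prod_insert hi, Finset.prod_insert hi, sub_mul, coeff_sub, coeff_C_mul]
    have h2 := mul_le_mul_of_nonneg_left (ih j) (norm_nonneg (z i))
    cases j with
    | zero =>
      have h0 : 0 ≤ ∏ i ∈ s, (t + ‖z i‖) := Finset.prod_nonneg fun i _ => by positivity
      rw [mul_coeff_zero, coeff_X_zero, zero_mul, zero_sub, norm_neg, norm_mul]
      nlinarith
    | succ j =>
      rw [coeff_X_mul]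
      have h1 := mul_le_mul_of_nonneg_left (ih j) ht
      calc _ ≤ (‖(∏ i ∈ s, (X - C (z i))).coeff j‖ + ‖z i‖ * ‖(∏ i ∈ s, (X - C (z i))).coeff (j + 1)‖)
            * t ^ (j + 1) := by
            gcongr
            exact (norm_sub_le _ _).trans (by rw [norm_mul])
        _ = t * (‖(∏ i ∈ s, (X - C (z i))).coeff j‖ * t ^ j) +
            ‖z i‖ * (‖(∏ i ∈ s, (X - C (z i))).coeff (j + 1)‖ * t ^ (j + 1)) := by ring
        _ ≤ _ := by rw [add_mul]; linarith

/-- A polynomial with a large coefficient is large in the mean: the geometric mean over the roots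
is replaced by the arithmetic one. -/
theorem sq_div_sq_add_sq_le {n : ℕ} (hn : 0 < n) (z : Fin n → ℂ) {L : ℂ} {A x t : ℝ} {j : ℕ}
    (ht : 1 ≤ t) (hz : ∀ i, t ≠ ‖z i‖) (hA : 0 < A) (hx : |x| = ‖L‖ * ∏ i, ‖(t : ℂ) - z i‖)
    (hAt : A * t ^ j ≤ ‖L‖ * ∏ i, (t + ‖z i‖)) (hj : n ≤ 2 * j) {α : ℝ} (hα : 0 < α)
    (hαA : α ≤ 2 * A) :
    α ^ 2 / (x ^ 2 + α ^ 2) ≤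
      2 * t ^ (-(1 / 4) : ℝ) * ∑ i, (1 / n : ℝ) * √((t + ‖z i‖) / |t - ‖z i‖|) := by
  have ht0 : 0 < t := by linarith
  have hn0 : (0 : ℝ) < n := by exact_mod_cast hn
  have hn1 : (1 : ℝ) ≤ n := by exact_mod_cast hn
  have hzp : ∀ i, 0 < |t - ‖z i‖| := fun i => abs_pos.2 (sub_ne_zero.2 (hz i))
  have hzn : ∀ i, |t - ‖z i‖| ≤ ‖(t : ℂ) - z i‖ := fun i => by
    have := abs_norm_sub_norm_le (t : ℂ) (z i)
    rwa [Complex.norm_real, Real.norm_of_nonneg ht0.le] at this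
  have hL : 0 < ‖L‖ := by
    rcases (norm_nonneg L).eq_or_lt with h | h
    · rw [← h, zero_mul] at hAt
      exact absurd hAt (not_le.2 (by positivity))
    · exact h
  have hP : 0 < ∏ i, |t - ‖z i‖| := Finset.prod_pos fun i _ => hzp i
  have hxl : ‖L‖ * ∏ i, |t - ‖z i‖| ≤ |x| := by
    rw [hx]; gcongr with i; exact hzn i
  have hx0 : 0 < |x| := lt_of_lt_of_le (by positivity) hxl
  -- The `n`-th root turns the product over the roots into a geometric mean; the further square root
  -- makes each singularity `|t - ‖z i‖|^{-1}` integrable.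
  set θ : ℝ := 1 / (2 * n) with hθ
  have hθ0 : 0 < θ := by positivity
  have hθ1 : θ ≤ 1 := by
    rw [hθ, div_le_one (by positivity)]; linarith
  -- The left side is at most `min(1, (α/|x|)²)`, hence at most any power of `α/|x|` with exponent
  -- in `(0, 1]`.
  have step1 : α ^ 2 / (x ^ 2 + α ^ 2) ≤ (α / |x|) ^ θ := by
    rcases le_total |x| α with h | h
    · calc α ^ 2 / (x ^ 2 + α ^ 2) ≤ 1 := by
            rw [div_le_one (by positivity)]; nlinarith
        _ ≤ _ := Real.one_le_rpow (by rwa [one_le_div hx0]) hθ0.le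
    · have h1 : α / |x| ≤ 1 := by rwa [div_le_one hx0]
      calc α ^ 2 / (x ^ 2 + α ^ 2) ≤ (α / |x|) ^ 2 := by
            rw [div_pow, sq_abs]
            have : 0 < x ^ 2 := by rw [← sq_abs]; positivity
            exact div_le_div_of_nonneg_left (by positivity) this (by nlinarith)
        _ ≤ α / |x| := by
            have : 0 < α / |x| := by positivity
            nlinarith
        _ = (α / |x|) ^ (1 : ℝ) := (Real.rpow_one _).symm
        _ ≤ _ := Real.rpow_le_rpow_of_exponent_ge (by positivity) h1 hθ1
  have step2 : α / |x| ≤ 2 * t ^ (-(j : ℝ)) * ∏ i, ((t + ‖z i‖) / |t - ‖z i‖|) := by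
    rw [div_le_iff₀ hx0, Finset.prod_div_distrib, Real.rpow_neg ht0.le, Real.rpow_natCast]
    calc α ≤ 2 * A := hαA
      _ = 2 * (t ^ j)⁻¹ * (A * t ^ j) := by field_simp
      _ ≤ 2 * (t ^ j)⁻¹ * (‖L‖ * ∏ i, (t + ‖z i‖)) := by gcongr
      _ = 2 * (t ^ j)⁻¹ * ((∏ i, (t + ‖z i‖)) / ∏ i, |t - ‖z i‖|) *
          (‖L‖ * ∏ i, |t - ‖z i‖|) := by field_simp
      _ ≤ _ := by
        refine mul_le_mul_of_nonneg_left hxl ?_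
        have : 0 ≤ ∏ i, (t + ‖z i‖) := Finset.prod_nonneg fun i _ => by positivity
        positivity
  have hr0 : ∀ i, 0 ≤ (t + ‖z i‖) / |t - ‖z i‖| := fun i => by positivity
  have step3 : (∏ i, ((t + ‖z i‖) / |t - ‖z i‖|)) ^ θ ≤
      ∑ i, (1 / n : ℝ) * √((t + ‖z i‖) / |t - ‖z i‖|) := by
    rw [← Real.finsetProd_rpow _ _ fun i _ => hr0 i]
    refine le_trans (le_of_eq ?_) (Real.geom_mean_le_arith_mean_weighted Finset.univ
      (fun _ => (1 / n : ℝ)) (fun i => √((t + ‖z i‖) / |t - ‖z i‖|)) (fun i _ => by positivity)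
      (by simp [hn0.ne']) fun i _ => Real.sqrt_nonneg _)
    refine Finset.prod_congr rfl fun i _ => ?_
    rw [Real.sqrt_eq_rpow, ← Real.rpow_mul (hr0 i), hθ]
    congr 1
    field_simp
  have hprod0 : 0 ≤ ∏ i, ((t + ‖z i‖) / |t - ‖z i‖|) := Finset.prod_nonneg fun i _ => hr0 i
  have step4 : (2 * t ^ (-(j : ℝ))) ^ θ ≤ 2 * t ^ (-(1 / 4) : ℝ) := by
    rw [Real.mul_rpow (by norm_num) (by positivity), ← Real.rpow_mul ht0.le]
    gcongr
    · calc (2 : ℝ) ^ θ ≤ 2 ^ (1 : ℝ) := Real.rpow_le_rpow_of_exponent_le (by norm_num) hθ1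
        _ = 2 := Real.rpow_one _
    · have hj' : (n : ℝ) ≤ 2 * j := by exact_mod_cast hj
      -- The hypothesis `n ≤ 2j` yields the decay `t^{-1/4}`, which makes the integral against
      -- `dt/t` converge at infinity.
      have : 1 / 4 ≤ (j : ℝ) * θ := by
        rw [hθ, mul_one_div, le_div_iff₀ (by positivity)]; linarith
      linarith
  calc _ ≤ (α / |x|) ^ θ := step1
    _ ≤ (2 * t ^ (-(j : ℝ)) * ∏ i, ((t + ‖z i‖) / |t - ‖z i‖|)) ^ θ :=
      Real.rpow_le_rpow (by positivity) step2 hθ0.le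
    _ = (2 * t ^ (-(j : ℝ))) ^ θ * (∏ i, ((t + ‖z i‖) / |t - ‖z i‖|)) ^ θ :=
      Real.mul_rpow (by positivity) hprod0
    _ ≤ _ := mul_le_mul step4 step3 (by positivity) (by positivity)

/-- An average over the roots of integrals each bounded by `kernelBound` is again so bounded,
whatever the degree. -/
theorem integral_sq_div_sq_add_sq_le {q : ℝ[X]} {j : ℕ} (hdeg : q.natDegree ≤ 2 * j) (hj : 0 < j)
    {α : ℝ} (hα : 0 < α) (hαq : α ≤ 2 * |q.coeff j|) {a b : ℝ} (ha : 1 ≤ a) (hab : a ≤ b) :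
    ∫ t in a..b, α ^ 2 / (q.eval t ^ 2 + α ^ 2) / t ≤ 2 * kernelBound := by
  have hc : 0 < |q.coeff j| := by linarith
  have hjq : j ≤ q.natDegree := le_natDegree_of_ne_zero (abs_pos.1 hc)
  obtain ⟨n, z, hn, hq⟩ := exists_map_eq_prod q
  have hn0 : 0 < n := by omega
  have hnR : (0 : ℝ) < n := by exact_mod_cast hn0
  have heval : ∀ t : ℝ, |q.eval t| = ‖(q.leadingCoeff : ℂ)‖ * ∏ i, ‖(t : ℂ) - z i‖ := fun t => by
    have h1 : ((q.eval t : ℝ) : ℂ) = (q.map (algebraMap ℝ ℂ)).eval (t : ℂ) :=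
      (eval_map_algebraMap q (t : ℂ)).symm ▸ (aeval_algebraMap_apply_eq_algebraMap_eval t q).symm
    rw [← Real.norm_eq_abs, ← Complex.norm_real, h1, hq, eval_mul, eval_C, eval_prod, norm_mul,
      norm_prod]
    simp
  have hcoef : ∀ t : ℝ, 0 ≤ t → |q.coeff j| * t ^ j ≤
      ‖(q.leadingCoeff : ℂ)‖ * ∏ i, (t + ‖z i‖) := fun t ht => by
    have h1 : ((q.coeff j : ℝ) : ℂ) = (q.map (algebraMap ℝ ℂ)).coeff j := by
      rw [coeff_map]; rfl
    rw [← Real.norm_eq_abs, ← Complex.norm_real, h1, hq, coeff_C_mul, norm_mul, mul_assoc]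
    gcongr
    exact norm_coeff_prod_mul_pow_le Finset.univ z ht j
  have hae : ∀ᵐ t : ℝ, ∀ i, t ≠ ‖z i‖ := by
    rw [ae_all_iff]
    intro i
    exact Measure.ae_ne volume _
  set g : ℝ → ℝ := fun t => 2 * ∑ i, (1 / n : ℝ) *
    (3 * t ^ (-(5 / 4) : ℝ) + 2 * kernelMajorant (t - ‖z i‖)) with hg
  have hle : ∀ᵐ t : ℝ, t ∈ Set.Ioc a b → α ^ 2 / (q.eval t ^ 2 + α ^ 2) / t ≤ g t := by
    filter_upwards [hae] with t htz ht
    have ht1 : 1 ≤ t := ha.trans ht.1.le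
    have ht0 : 0 < t := by linarith
    have h1 := sq_div_sq_add_sq_le hn0 z ht1 htz hc (heval t) (hcoef t ht0.le) (by omega) hα hαq
    have e : t ^ (-(1 / 4) : ℝ) / t = t ^ (-(5 / 4) : ℝ) := by
      conv_lhs => rw [← Real.rpow_sub_one ht0.ne']
      norm_num
    calc _ ≤ 2 * t ^ (-(1 / 4) : ℝ) * (∑ i, (1 / n : ℝ) * √((t + ‖z i‖) / |t - ‖z i‖|)) / t := by
          gcongr
      _ = 2 * ∑ i, (1 / n : ℝ) * (t ^ (-(5 / 4) : ℝ) * √((t + ‖z i‖) / |t - ‖z i‖|)) := by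
          rw [← e, mul_div_assoc, mul_assoc, mul_div_assoc', Finset.mul_sum, Finset.sum_div]
          congr 1
          refine Finset.sum_congr rfl fun i _ => ?_
          ring
      _ ≤ _ := by
          simp only [hg]
          gcongr with i
          exact rpow_mul_sqrt_div_le ht1 (htz i)
  have hgi : ∀ i ∈ (Finset.univ : Finset (Fin n)), IntervalIntegrable (fun t => (1 / n : ℝ) *
      (3 * t ^ (-(5 / 4) : ℝ) + 2 * kernelMajorant (t - ‖z i‖))) volume a b := fun i _ =>
    (intervalIntegrable_kernel ha hab _).const_mul _
  have hgI : IntervalIntegrable g volume a b := by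
    refine IntervalIntegrable.const_mul ?_ 2
    refine (IntervalIntegrable.sum Finset.univ hgi).congr fun t _ => ?_
    simp only [Finset.sum_apply]
  have hcont : IntervalIntegrable (fun t => α ^ 2 / (q.eval t ^ 2 + α ^ 2) / t) volume a b := by
    refine ContinuousOn.intervalIntegrable ?_
    rw [Set.uIcc_of_le hab]
    refine ContinuousOn.div (Continuous.continuousOn ?_) continuousOn_id fun t ht => ?_
    · exact continuous_const.div ((q.continuous.pow 2).add continuous_const) fun t => by positivity
    · have := ht.1; exact (by linarith : (0 : ℝ) < t).ne'
  calc _ ≤ ∫ t in a..b, g t := by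
        refine intervalIntegral.integral_mono_ae_restrict hab hcont hgI ?_
        rw [← Measure.restrict_congr_set Ioc_ae_eq_Icc]
        exact (ae_restrict_iff' measurableSet_Ioc).2 hle
    _ = 2 * ∑ i, (1 / n : ℝ) * ∫ t in a..b,
        (3 * t ^ (-(5 / 4) : ℝ) + 2 * kernelMajorant (t - ‖z i‖)) := by
        simp only [hg]
        rw [intervalIntegral.integral_const_mul, intervalIntegral.integral_finsetSum hgi]
        simp only [intervalIntegral.integral_const_mul]
    _ ≤ 2 * ∑ i : Fin n, (1 / n : ℝ) * kernelBound := by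
        gcongr with i
        exact integral_kernel_le ha hab _
    _ = 2 * kernelBound := by
        rw [Finset.sum_const, Finset.card_univ, Fintype.card_fin, nsmul_eq_mul]
        field_simp

/-! ### Oscillatory integrals with polynomial phase -/

theorem continuous_cexp_I_mul {φ : ℝ → ℝ} (hφ : Continuous φ) :
    Continuous fun t => Complex.exp (Complex.I * (φ t : ℝ)) := by fun_prop

theorem norm_cexp_I_mul (x : ℝ) : ‖Complex.exp (Complex.I * (x : ℝ))‖ = 1 := by
  rw [mul_comm]; exact Complex.norm_exp_ofReal_mul_I x

theorem abs_div_sq_add_sq_le (x : ℝ) {α : ℝ} (hα : 0 < α) :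
    |x / (x ^ 2 + α ^ 2)| ≤ 1 / (2 * α) := by
  have : 0 < x ^ 2 + α ^ 2 := by positivity
  rw [abs_div, abs_of_pos this, div_le_div_iff₀ this (by positivity)]
  nlinarith [sq_nonneg (|x| - α), sq_abs x]

theorem hasDerivAt_eval_div (q : ℝ[X]) {α : ℝ} (hα : 0 < α) (t : ℝ) :
    HasDerivAt (fun t => q.eval t / (q.eval t ^ 2 + α ^ 2))
      ((derivative q * (C (α ^ 2) - q ^ 2)).eval t / (q.eval t ^ 2 + α ^ 2) ^ 2) t := by
  have h := q.hasDerivAt t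
  have h0 : q.eval t ^ 2 + α ^ 2 ≠ 0 := by positivity
  refine (h.div ((h.pow 2).add_const (α ^ 2)) h0).congr_deriv ?_
  simp only [eval_mul, eval_sub, eval_C, eval_pow, Nat.cast_ofNat, Pi.pow_apply]
  ring

/-- The total variation of `q / (q² + α²)` is `O(deg q / α)`. -/
theorem integral_abs_deriv_eval_div_le (q : ℝ[X]) {α : ℝ} (hα : 0 < α) {a b : ℝ} (hab : a ≤ b) :
    ∫ t in a..b, |(derivative q * (C (α ^ 2) - q ^ 2)).eval t / (q.eval t ^ 2 + α ^ 2) ^ 2| ≤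
      (3 * q.natDegree + 1) / α := by
  set N := derivative q * (C (α ^ 2) - q ^ 2) with hN
  by_cases hN0 : N = 0
  · simp only [hN0, eval_zero, zero_div, abs_zero, intervalIntegral.integral_zero]
    positivity
  · have hcont : Continuous fun t => N.eval t / (q.eval t ^ 2 + α ^ 2) ^ 2 :=
      N.continuous.div (((q.continuous.pow 2).add continuous_const).pow 2) fun t => by positivity
    have h := integral_abs_deriv_le (hasDerivAt_eval_div q hα) hcont
      (fun t => abs_div_sq_add_sq_le (q.eval t) hα) N.roots.toFinset.card N.roots.toFinset a b hab
      le_rfl fun x _ hx => by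
        have : (q.eval x ^ 2 + α ^ 2) ^ 2 ≠ 0 := by positivity
        rw [div_eq_zero_iff, or_iff_left this] at hx
        exact Multiset.mem_toFinset.2 ((mem_roots hN0).2 hx)
    have hdeg : N.natDegree ≤ 3 * q.natDegree := by
      refine natDegree_mul_le.trans ?_
      have h1 : (derivative q).natDegree ≤ q.natDegree := (natDegree_derivative_le q).trans (by omega)
      have h2 : (C (α ^ 2) - q ^ 2).natDegree ≤ 2 * q.natDegree := by
        refine (natDegree_sub_le _ _).trans ?_
        rw [natDegree_C]
        exact max_le (by omega) natDegree_pow_le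
      omega
    have hcard : (N.roots.toFinset.card : ℝ) ≤ 3 * q.natDegree := by
      exact_mod_cast (Multiset.toFinset_card_le _).trans ((card_roots' N).trans hdeg)
    refine h.trans ?_
    have e : (3 * q.natDegree + 1 : ℝ) / α = 2 * (1 / (2 * α)) * (3 * q.natDegree + 1) := by
      field_simp
    rw [e]
    gcongr

/-- A bound for `∫ e^{iP(t)} dt/t` on the far side of a coefficient of size one. -/
theorem norm_integral_polynomial_phase_le {P : ℝ[X]} {j : ℕ} (hj : 0 < j)
    (hdeg : P.natDegree ≤ 2 * j) (hc : 1 ≤ |P.coeff j|) {a b : ℝ} (ha : 1 ≤ a) (hab : a ≤ b) :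
    ‖∫ t in a..b, Complex.exp (Complex.I * (P.eval t : ℝ)) / (t : ℂ)‖ ≤ 5 + 2 * kernelBound := by
  have hPj : P.coeff j ≠ 0 := fun h => by rw [h] at hc; norm_num at hc
  have hjD : j ≤ P.natDegree := le_natDegree_of_ne_zero hPj
  -- This size balances the two errors: the variation of `f` is `O(deg q / α)`, while the remainder
  -- needs `α ≤ 2|q.coeff j|`.
  set α : ℝ := (P.natDegree : ℝ) with hαdef
  have hα1 : 1 ≤ α := by rw [hαdef]; exact_mod_cast hj.trans_le hjD
  have hα : 0 < α := by linarith
  set q : ℝ[X] := X * derivative P with hq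
  have hqcoef : q.coeff j = P.coeff j * j := by
    obtain ⟨k, rfl⟩ := Nat.exists_eq_succ_of_ne_zero hj.ne'
    rw [hq, coeff_X_mul, coeff_derivative]; push_cast; rfl
  have hqdeg : q.natDegree ≤ P.natDegree := by
    refine natDegree_mul_le.trans ?_
    have := natDegree_derivative_le P
    rw [natDegree_X]
    omega
  set f : ℝ → ℝ := fun t => q.eval t / (q.eval t ^ 2 + α ^ 2) with hf
  set f' : ℝ → ℝ := fun t =>
    (derivative q * (C (α ^ 2) - q ^ 2)).eval t / (q.eval t ^ 2 + α ^ 2) ^ 2 with hf'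
  have hf'cont : Continuous f' :=
    (Polynomial.continuous _).div (((q.continuous.pow 2).add continuous_const).pow 2)
      fun t => by positivity
  set E : ℝ → ℂ := fun t => Complex.exp (Complex.I * (P.eval t : ℝ)) with hE
  have hEcont : Continuous E := continuous_cexp_I_mul P.continuous
  have hEn : ∀ t, ‖E t‖ = 1 := fun t => norm_cexp_I_mul _
  set E' : ℝ → ℂ := fun t => E t * (Complex.I * ((derivative P).eval t : ℝ)) with hE'
  have hE'cont : Continuous E' := hEcont.mul
    (continuous_const.mul (Complex.continuous_ofReal.comp (derivative P).continuous))
  have hEd : ∀ t, HasDerivAt E (E' t) t := fun t =>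
    (((P.hasDerivAt t).ofReal_comp).const_mul Complex.I).cexp
  have hfd : ∀ t, HasDerivAt (fun t => (f t : ℂ)) (f' t) t := fun t =>
    (hasDerivAt_eval_div q hα t).ofReal_comp
  have hpos : ∀ t ∈ Set.uIcc a b, (0 : ℝ) < t := fun t ht => by
    rw [Set.uIcc_of_le hab] at ht; linarith [ht.1]
  have hrem : ContinuousOn (fun t => α ^ 2 / (q.eval t ^ 2 + α ^ 2) / t) (Set.uIcc a b) := by
    refine ContinuousOn.div (Continuous.continuousOn ?_) continuousOn_id fun t ht => (hpos t ht).ne'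
    exact continuous_const.div ((q.continuous.pow 2).add continuous_const) fun t => by positivity
  -- This is `1 = q²/(q² + α²) + α²/(q² + α²)`: away from the zeros of `P'` the first term is nearly
  -- everything and is integrated by parts without ever dividing by `P'`.
  have hsplit : ∀ t ∈ Set.uIcc a b, E t / (t : ℂ) = -Complex.I * ((f t : ℂ) * E' t) +
      E t * ((α ^ 2 / (q.eval t ^ 2 + α ^ 2) / t : ℝ) : ℂ) := fun t ht => by
    have ht0 : (t : ℂ) ≠ 0 := by exact_mod_cast (hpos t ht).ne'
    have hd : ((q.eval t ^ 2 + α ^ 2 : ℝ) : ℂ) ≠ 0 := by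
      have : (0 : ℝ) < q.eval t ^ 2 + α ^ 2 := by positivity
      exact_mod_cast this.ne'
    have hqt : ((q.eval t : ℝ) : ℂ) = t * ((derivative P).eval t : ℝ) := by
      rw [hq, eval_mul, eval_X]; push_cast; rfl
    simp only [hf, hE']
    push_cast at hd ⊢
    field_simp
    rw [Complex.I_sq, hqt]
    ring
  have hI1 : IntervalIntegrable (fun t => (f t : ℂ) * E' t) volume a b := by
    refine Continuous.intervalIntegrable (Continuous.mul ?_ hE'cont) _ _
    exact continuous_iff_continuousAt.2 fun t => (hfd t).continuousAt
  have hI2 : IntervalIntegrable (fun t => E t * ((α ^ 2 / (q.eval t ^ 2 + α ^ 2) / t : ℝ) : ℂ))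
      volume a b := by
    refine ContinuousOn.intervalIntegrable (hEcont.continuousOn.mul ?_)
    exact Complex.continuous_ofReal.comp_continuousOn hrem
  have hf'I : IntervalIntegrable (fun t => (f' t : ℂ)) volume a b :=
    (Complex.continuous_ofReal.comp hf'cont).intervalIntegrable _ _
  have hparts := intervalIntegral.integral_mul_deriv_eq_deriv_mul (a := a) (b := b)
    (fun t _ => hfd t) (fun t _ => hEd t) hf'I (hE'cont.intervalIntegrable _ _)
  have hb : ∀ t, ‖(f t : ℂ) * E t‖ ≤ 1 / (2 * α) := fun t => by
    rw [norm_mul, hEn, mul_one, Complex.norm_real]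
    exact abs_div_sq_add_sq_le _ hα
  have hvar : ‖∫ t in a..b, (f' t : ℂ) * E t‖ ≤ (3 * q.natDegree + 1) / α := by
    refine (intervalIntegral.norm_integral_le_integral_norm hab).trans ?_
    simp only [norm_mul, hEn, mul_one, Complex.norm_real, Real.norm_eq_abs]
    exact integral_abs_deriv_eval_div_le q hα hab
  have hfirst : ‖∫ t in a..b, (f t : ℂ) * E' t‖ ≤ 5 := by
    rw [hparts]
    refine (norm_sub_le _ _).trans ((add_le_add ((norm_sub_le _ _).trans
      (add_le_add (hb b) (hb a))) hvar).trans ?_)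
    have h1 : (q.natDegree : ℝ) ≤ α := by rw [hαdef]; exact_mod_cast hqdeg
    rw [← add_div, div_add_div _ _ (by positivity) hα.ne', div_le_iff₀ (by positivity)]
    nlinarith
  have hsecond : ‖∫ t in a..b, E t * ((α ^ 2 / (q.eval t ^ 2 + α ^ 2) / t : ℝ) : ℂ)‖ ≤
      2 * kernelBound := by
    have hjR : (0 : ℝ) < j := by exact_mod_cast hj
    -- Passing from `P` to `q = tP'` multiplies the coefficient by `j`, and `j` is at least half the
    -- degree.
    have hαj : α ≤ 2 * |q.coeff j| := by
      have h2 : α ≤ 2 * j := by rw [hαdef]; exact_mod_cast hdeg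
      rw [hqcoef, abs_mul, abs_of_pos hjR]
      nlinarith
    refine le_trans ?_ (integral_sq_div_sq_add_sq_le (hqdeg.trans hdeg) hj hα hαj ha hab)
    refine intervalIntegral.norm_integral_le_of_norm_le hab (ae_of_all _ fun t ht => ?_)
      hrem.intervalIntegrable
    have ht0 : 0 < t := by linarith [ht.1]
    rw [norm_mul, hEn, one_mul, Complex.norm_real, Real.norm_of_nonneg (by positivity)]
  rw [intervalIntegral.integral_congr hsplit, intervalIntegral.integral_add (hI1.const_mul _) hI2,
    intervalIntegral.integral_const_mul]
  refine (norm_add_le _ _).trans (add_le_add ?_ hsecond)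
  rwa [norm_mul, norm_neg, Complex.norm_I, one_mul]

/-- The symmetrised oscillatory integral `∫_{a ≤ |t| ≤ b} e^{iφ(t)} dt/t`. -/
def oddOsc (φ : ℝ → ℝ) (a b : ℝ) : ℂ :=
  ∫ t in a..b, (Complex.exp (Complex.I * (φ t : ℝ)) - Complex.exp (Complex.I * (φ (-t) : ℝ))) / (t : ℂ)

theorem norm_cexp_sub_cexp_le (x y : ℝ) :
    ‖Complex.exp (Complex.I * (x : ℝ)) - Complex.exp (Complex.I * (y : ℝ))‖ ≤ |x - y| := by
  have e : Complex.exp (Complex.I * (x : ℝ)) - Complex.exp (Complex.I * (y : ℝ)) =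
      Complex.exp (Complex.I * (y : ℝ)) * (Complex.exp (Complex.I * (x - y : ℝ)) - 1) := by
    rw [mul_sub, ← Complex.exp_add, mul_one]
    push_cast
    ring_nf
  rw [e, norm_mul, norm_cexp_I_mul, one_mul]
  exact Real.norm_exp_I_mul_ofReal_sub_one_le

theorem continuousOn_oddOsc_integrand {φ : ℝ → ℝ} {r : ℝ} (hφ : ContinuousOn φ (Set.Icc (-r) r)) :
    ContinuousOn (fun t : ℝ => (Complex.exp (Complex.I * (φ t : ℝ)) -
      Complex.exp (Complex.I * (φ (-t) : ℝ))) / (t : ℂ)) (Set.Ioc 0 r) := by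
  have h1 : ContinuousOn φ (Set.Ioc 0 r) := hφ.mono fun t ht => ⟨by linarith [ht.1, ht.2], ht.2⟩
  have h2 : ContinuousOn (fun t => φ (-t)) (Set.Ioc 0 r) :=
    hφ.comp continuous_neg.continuousOn fun t ht => ⟨by linarith [ht.2], by linarith [ht.1, ht.2]⟩
  have hexp : ∀ χ : ℝ → ℝ, ContinuousOn χ (Set.Ioc 0 r) →
      ContinuousOn (fun t => Complex.exp (Complex.I * (χ t : ℝ))) (Set.Ioc 0 r) := fun χ hχ =>
    Complex.continuous_exp.comp_continuousOn
      (continuousOn_const.mul (Complex.continuous_ofReal.comp_continuousOn hχ))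
  refine ((hexp _ h1).sub (hexp _ h2)).div Complex.continuous_ofReal.continuousOn fun t ht => ?_
  exact_mod_cast ht.1.ne'

theorem intervalIntegrable_oddOsc {φ : ℝ → ℝ} {a b r : ℝ} (hφ : ContinuousOn φ (Set.Icc (-r) r))
    (ha : 0 < a) (hab : a ≤ b) (hbr : b ≤ r) :
    IntervalIntegrable (fun t : ℝ => (Complex.exp (Complex.I * (φ t : ℝ)) -
      Complex.exp (Complex.I * (φ (-t) : ℝ))) / (t : ℂ)) volume a b := by
  refine ((continuousOn_oddOsc_integrand hφ).mono fun t ht => ?_).intervalIntegrable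
  rw [Set.uIcc_of_le hab] at ht
  exact ⟨ha.trans_le ht.1, ht.2.trans hbr⟩

theorem oddOsc_add {φ : ℝ → ℝ} {a b c r : ℝ} (hφ : ContinuousOn φ (Set.Icc (-r) r))
    (ha : 0 < a) (hab : a ≤ b) (hbc : b ≤ c) (hcr : c ≤ r) :
    oddOsc φ a b + oddOsc φ b c = oddOsc φ a c :=
  intervalIntegral.integral_add_adjacent_intervals
    (intervalIntegrable_oddOsc hφ ha hab (hbc.trans hcr))
    (intervalIntegrable_oddOsc hφ (ha.trans_le hab) hbc hcr)

/-- The factor `|t|` in the phase difference cancels `1/t`; the 2 counts the two half-lines. -/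
theorem norm_oddOsc_sub_le {φ χ : ℝ → ℝ} {a b r : ℝ} (hφ : ContinuousOn φ (Set.Icc (-r) r))
    (hχ : ContinuousOn χ (Set.Icc (-r) r)) (ha : 0 < a) (hab : a ≤ b) (hbr : b ≤ r) {g : ℝ → ℝ}
    (hg : ∀ t, |t| ≤ b → |φ t - χ t| ≤ |t| * g |t|) (hgc : Continuous g) :
    ‖oddOsc φ a b - oddOsc χ a b‖ ≤ 2 * ∫ t in a..b, g t := by
  unfold oddOsc
  rw [← intervalIntegral.integral_sub (intervalIntegrable_oddOsc hφ ha hab hbr)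
    (intervalIntegrable_oddOsc hχ ha hab hbr), ← intervalIntegral.integral_const_mul]
  refine intervalIntegral.norm_integral_le_of_norm_le hab (ae_of_all _ fun t ht => ?_)
    ((hgc.intervalIntegrable _ _).const_mul 2)
  have ht0 : 0 < t := ha.trans ht.1
  have h1 := (norm_cexp_sub_cexp_le _ _).trans (hg t (by rw [abs_of_pos ht0]; exact ht.2))
  have h2 := (norm_cexp_sub_cexp_le _ _).trans
    (hg (-t) (by rw [abs_neg, abs_of_pos ht0]; exact ht.2))
  rw [abs_neg] at h2
  rw [abs_of_pos ht0] at h1 h2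
  rw [← sub_div, norm_div, Complex.norm_real, Real.norm_of_nonneg ht0.le, div_le_iff₀ ht0,
    sub_sub_sub_comm]
  refine (norm_sub_le _ _).trans ?_
  linarith

theorem norm_oddOsc_le_log {φ : ℝ → ℝ} {a b : ℝ} (ha : 0 < a) (hab : a ≤ b) :
    ‖oddOsc φ a b‖ ≤ 2 * Real.log (b / a) := by
  rw [← integral_one_div_of_pos ha (ha.trans_le hab), ← intervalIntegral.integral_const_mul]
  refine intervalIntegral.norm_integral_le_of_norm_le hab (ae_of_all _ fun t ht => ?_) ?_
  · have ht0 : 0 < t := ha.trans ht.1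
    rw [norm_div, Complex.norm_real, Real.norm_of_nonneg ht0.le, mul_one_div]
    gcongr
    refine (norm_sub_le _ _).trans ?_
    rw [norm_cexp_I_mul, norm_cexp_I_mul]; norm_num
  · refine ContinuousOn.intervalIntegrable ?_
    rw [Set.uIcc_of_le hab]
    refine continuousOn_const.mul (continuousOn_const.div continuousOn_id fun t ht => ?_)
    exact (ha.trans_le ht.1).ne'

/-- The measure `dt/t` is invariant under dilation, so `ρ` scales to 1. The half-lines are bounded
separately, for here no cancellation between them is needed. -/
theorem norm_oddOsc_far_le {P : ℝ[X]} {j : ℕ} (hj : 0 < j) (hdeg : P.natDegree ≤ 2 * j) {ρ : ℝ}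
    (hρ : 0 < ρ) (hc : 1 ≤ |P.coeff j| * ρ ^ j) {a b : ℝ} (ha : ρ ≤ a) (hab : a ≤ b) :
    ‖oddOsc (fun t => P.eval t) a b‖ ≤ 2 * (5 + 2 * kernelBound) := by
  have key : ∀ σ : ℝ, |σ| = 1 →
      ‖∫ t in a..b, Complex.exp (Complex.I * (P.eval (σ * t) : ℝ)) / (t : ℂ)‖ ≤
        5 + 2 * kernelBound := fun σ hσ => by
    have hcomp : ∀ t, (P.comp (C (σ * ρ) * X)).eval t = P.eval (σ * (ρ * t)) := fun t => by
      simp [eval_comp, mul_assoc]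
    have hdeg' : (P.comp (C (σ * ρ) * X)).natDegree ≤ 2 * j := by
      refine natDegree_comp_le.trans ?_
      have : (C (σ * ρ) * X : ℝ[X]).natDegree ≤ 1 := (natDegree_C_mul_le _ _).trans natDegree_X_le
      nlinarith
    have hc' : 1 ≤ |(P.comp (C (σ * ρ) * X)).coeff j| := by
      rw [comp_C_mul_X_coeff, abs_mul, abs_pow, abs_mul, hσ, one_mul, abs_of_pos hρ]; exact hc
    have h := norm_integral_polynomial_phase_le hj hdeg' hc' (a := a / ρ) (b := b / ρ)
      (by rwa [one_le_div hρ]) (by gcongr)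
    have hsub := intervalIntegral.integral_comp_mul_left (a := a / ρ) (b := b / ρ)
      (fun t : ℝ => Complex.exp (Complex.I * (P.eval (σ * t) : ℝ)) / (t : ℂ)) hρ.ne'
    rw [mul_div_cancel₀ _ hρ.ne', mul_div_cancel₀ _ hρ.ne', eq_inv_smul_iff₀ hρ.ne',
      ← intervalIntegral.integral_smul] at hsub
    rw [← hsub]
    convert h using 3
    ext t
    rw [hcomp]
    have hρC : (ρ : ℂ) ≠ 0 := by exact_mod_cast hρ.ne'
    rw [Complex.real_smul]
    push_cast
    field_simp
  have hI : ∀ σ : ℝ, IntervalIntegrable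
      (fun t : ℝ => Complex.exp (Complex.I * (P.eval (σ * t) : ℝ)) / (t : ℂ)) volume a b := fun σ => by
    refine ContinuousOn.intervalIntegrable ?_
    rw [Set.uIcc_of_le hab]
    refine (continuous_cexp_I_mul (P.continuous.comp (continuous_const_mul σ))).continuousOn.div
      Complex.continuous_ofReal.continuousOn fun t ht => ?_
    exact_mod_cast (hρ.trans_le (ha.trans ht.1)).ne'
  have h1 := key 1 (by simp)
  have h2 := key (-1) (by simp)
  have e : oddOsc (fun t => P.eval t) a b =
      (∫ t in a..b, Complex.exp (Complex.I * (P.eval (1 * t) : ℝ)) / (t : ℂ)) -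
      ∫ t in a..b, Complex.exp (Complex.I * (P.eval (-1 * t) : ℝ)) / (t : ℂ) := by
    rw [← intervalIntegral.integral_sub (hI 1) (hI (-1))]
    simp only [oddOsc, one_mul, neg_one_mul, sub_div]
  rw [e]
  refine (norm_sub_le _ _).trans ?_
  linarith

/-- The increment of the bound for polynomial phases when the degree doubles. -/
def polynomialConst : ℝ := 2 + 2 * (5 + 2 * kernelBound)

theorem polynomialConst_nonneg : 0 ≤ polynomialConst := by
  have := kernelBound_nonneg
  unfold polynomialConst
  positivity

/-! ### Polynomial phases: induction on the doubling of the degree -/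

theorem exists_scale {c : ℕ → ℝ} {H : Finset ℕ} (hH : ∀ j ∈ H, 0 < j) (hne : ∃ j ∈ H, c j ≠ 0) :
    ∃ ρ : ℝ, 0 < ρ ∧ (∃ j ∈ H, 1 ≤ |c j| * ρ ^ j) ∧ ∀ j ∈ H, |c j| * ρ ^ j ≤ 1 := by
  have hpow : ∀ j ∈ H, c j ≠ 0 → |c j| * (|c j| ^ (-(1 / j : ℝ))) ^ j = 1 := fun j hj h0 => by
    have h1 : 0 < |c j| := abs_pos.2 h0
    have hj0 : (j : ℝ) ≠ 0 := by exact_mod_cast (hH j hj).ne'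
    rw [← Real.rpow_natCast, ← Real.rpow_mul h1.le]
    have : -(1 / j : ℝ) * j = -1 := by field_simp
    rw [this, Real.rpow_neg_one, mul_inv_cancel₀ h1.ne']
  -- The term `|c j| ρ^j` reaches 1 at `ρ = |c j|^{-1/j}`; the least of these radii is the one at
  -- which the first term does.
  obtain ⟨j₀, hj₀, hmin⟩ := (H.filter (fun j => c j ≠ 0)).exists_min_image
    (fun j => |c j| ^ (-(1 / j : ℝ))) (by
      obtain ⟨j, hj, h0⟩ := hne
      exact ⟨j, Finset.mem_filter.2 ⟨hj, h0⟩⟩)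
  rw [Finset.mem_filter] at hj₀
  have hρ : 0 < |c j₀| ^ (-(1 / j₀ : ℝ)) := Real.rpow_pos_of_pos (abs_pos.2 hj₀.2) _
  refine ⟨_, hρ, ⟨j₀, hj₀.1, (hpow j₀ hj₀.1 hj₀.2).ge⟩, fun j hj => ?_⟩
  by_cases h0 : c j = 0
  · simp [h0]
  · refine le_trans ?_ (hpow j hj h0).le
    gcongr
    exact hmin j (Finset.mem_filter.2 ⟨hj, h0⟩)

theorem sum_Ico_inv_le_one (N : ℕ) (hN : 0 < N) : ∑ j ∈ Finset.Ico N (2 * N), (1 / j : ℝ) ≤ 1 := by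
  have hN' : (0 : ℝ) < N := by exact_mod_cast hN
  calc ∑ j ∈ Finset.Ico N (2 * N), (1 / j : ℝ) ≤ ∑ j ∈ Finset.Ico N (2 * N), (1 / N : ℝ) := by
        refine Finset.sum_le_sum fun j hj => ?_
        have := (Finset.mem_Ico.1 hj).1
        gcongr
    _ = 1 := by
        rw [Finset.sum_const, Nat.card_Ico, nsmul_eq_mul, two_mul, Nat.add_sub_cancel]
        field_simp

/-- The truncation of a polynomial to its coefficients of index less than `N`. -/
def lowPart (P : ℝ[X]) (N : ℕ) : ℝ[X] := ∑ j ∈ Finset.range N, monomial j (P.coeff j)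

theorem natDegree_lowPart_lt (P : ℝ[X]) {N : ℕ} (hN : 0 < N) : (lowPart P N).natDegree < N := by
  have : (lowPart P N).natDegree ≤ N - 1 := by
    refine natDegree_sum_le_of_forall_le _ _ fun j hj => (natDegree_monomial_le _).trans ?_
    have := Finset.mem_range.1 hj
    omega
  omega

theorem eval_sub_eval_lowPart {P : ℝ[X]} {N : ℕ} (hP : P.natDegree < 2 * N) (t : ℝ) :
    P.eval t - (lowPart P N).eval t = ∑ j ∈ Finset.Ico N (2 * N), P.coeff j * t ^ j := by
  rw [eval_eq_sum_range' hP, lowPart, eval_finsetSum, Finset.sum_Ico_eq_sub _ (by omega)]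
  simp only [eval_monomial]

/-- Below `ρ` the monomial of index `j` contributes at most `1/j` to the integral against `dt/t`,
and these sum to at most 1 over `[N, 2N)`. -/
theorem norm_oddOsc_sub_lowPart_le {P : ℝ[X]} {N : ℕ} (hN : 0 < N) (hP : P.natDegree < 2 * N)
    {ρ : ℝ} (hρ : 0 < ρ) (hc : ∀ j ∈ Finset.Ico N (2 * N), |P.coeff j| * ρ ^ j ≤ 1) {a b : ℝ}
    (ha : 0 < a) (hab : a ≤ b) (hb : b ≤ ρ) :
    ‖oddOsc (fun t => P.eval t) a b - oddOsc (fun t => (lowPart P N).eval t) a b‖ ≤ 2 := by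
  have hg : ∀ t : ℝ, |t| ≤ b → |P.eval t - (lowPart P N).eval t| ≤
      |t| * ∑ j ∈ Finset.Ico N (2 * N), |t| ^ (j - 1) / ρ ^ j := fun t _ => by
    rw [eval_sub_eval_lowPart hP, Finset.mul_sum]
    refine (Finset.abs_sum_le_sum_abs _ _).trans (Finset.sum_le_sum fun j hj => ?_)
    have hj0 : j ≠ 0 := by have := (Finset.mem_Ico.1 hj).1; omega
    rw [abs_mul, abs_pow, mul_div_assoc', mul_pow_sub_one hj0, le_div_iff₀ (by positivity)]
    have := mul_le_mul_of_nonneg_right (hc j hj) (by positivity : 0 ≤ |t| ^ j)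
    linarith
  refine (norm_oddOsc_sub_le P.continuous.continuousOn (lowPart P N).continuous.continuousOn ha hab
    le_rfl (g := fun t => ∑ j ∈ Finset.Ico N (2 * N), t ^ (j - 1) / ρ ^ j) hg
    (by fun_prop)).trans ?_
  have hb0 : 0 < b := ha.trans_le hab
  have hint : ∫ t in a..b, ∑ j ∈ Finset.Ico N (2 * N), t ^ (j - 1) / ρ ^ j ≤ 1 := by
    rw [intervalIntegral.integral_finsetSum
      fun j _ => (Continuous.intervalIntegrable (by fun_prop) _ _)]
    refine le_trans (Finset.sum_le_sum fun j hj => ?_) (sum_Ico_inv_le_one N hN)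
    have hj0 : 0 < j := by have := (Finset.mem_Ico.1 hj).1; omega
    have hjR : (0 : ℝ) < j := by exact_mod_cast hj0
    rw [intervalIntegral.integral_div, integral_pow, Nat.sub_add_cancel hj0, Nat.cast_pred hj0,
      sub_add_cancel, div_div, div_le_div_iff₀ (by positivity) hjR]
    have h1 : b ^ j ≤ ρ ^ j := by gcongr
    have h2 : 0 ≤ a ^ j := by positivity
    nlinarith
  linarith

/-- Bounded cost per doubling gives a bound logarithmic in the degree. The symmetry of the domain
enters in the base case, where a constant phase makes the integrand vanish. -/
theorem norm_oddOsc_polynomial_le (n : ℕ) : ∀ P : ℝ[X], P.natDegree < 2 ^ n → ∀ a b : ℝ, 0 < a →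
    a ≤ b → ‖oddOsc (fun t => P.eval t) a b‖ ≤ n * polynomialConst := by
  have hK := kernelBound_nonneg
  induction n with
  | zero =>
    intro P hP a b _ _
    rw [pow_zero, Nat.lt_one_iff] at hP
    rw [eq_C_of_natDegree_eq_zero hP]
    simp [oddOsc]
  | succ n ih =>
    intro P hP a b ha hab
    rw [pow_succ'] at hP
    have hN : 0 < 2 ^ n := by positivity
    push_cast
    rw [add_mul, one_mul]
    by_cases hne : ∃ j ∈ Finset.Ico (2 ^ n) (2 * 2 ^ n), P.coeff j ≠ 0
    · obtain ⟨ρ, hρ, ⟨j, hj, hj1⟩, hsmall⟩ := exists_scale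
        (fun j hj => lt_of_lt_of_le hN (Finset.mem_Ico.1 hj).1) hne
      have hj' := Finset.mem_Ico.1 hj
      have near : ∀ a b : ℝ, 0 < a → a ≤ b → b ≤ ρ →
          ‖oddOsc (fun t => P.eval t) a b‖ ≤ n * polynomialConst + 2 := fun a b ha hab hb => by
        have h1 := norm_oddOsc_sub_lowPart_le hN hP hρ hsmall ha hab hb
        have h2 := ih _ (natDegree_lowPart_lt P hN) a b ha hab
        have h3 := norm_le_norm_add_norm_sub' (oddOsc (fun t => P.eval t) a b)
          (oddOsc (fun t => (lowPart P (2 ^ n)).eval t) a b)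
        linarith
      have far : ∀ a b : ℝ, ρ ≤ a → a ≤ b →
          ‖oddOsc (fun t => P.eval t) a b‖ ≤ 2 * (5 + 2 * kernelBound) := fun a b ha hab =>
        norm_oddOsc_far_le (hN.trans_le hj'.1) (by omega) hρ hj1 ha hab
      have hn0 : 0 ≤ n * polynomialConst := mul_nonneg (by positivity) polynomialConst_nonneg
      have hdef : polynomialConst = 2 + 2 * (5 + 2 * kernelBound) := rfl
      rcases le_total b ρ with hb | hb
      · linarith [near a b ha hab hb]
      · rcases le_total a ρ with ha' | ha'
        · rw [← oddOsc_add P.continuous.continuousOn ha ha' hb le_rfl]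
          refine (norm_add_le _ _).trans ?_
          linarith [near a ρ ha ha' le_rfl, far ρ b le_rfl hb]
        · linarith [far a b ha' hab]
    · push Not at hne
      have hP' : P.natDegree < 2 ^ n := by
        by_contra hcon
        have h0 := hne P.natDegree (Finset.mem_Ico.2 ⟨not_lt.1 hcon, hP⟩)
        rw [coeff_natDegree, leadingCoeff_eq_zero] at h0
        rw [h0, natDegree_zero] at hcon
        exact hcon hN
      linarith [ih P hP' a b ha hab, polynomialConst_nonneg]

/-! ### Existence of the principal value -/

theorem truncated_eq_oddOsc {r : ℝ} {ψ : ℝ → ℝ} (hψ : ContinuousOn ψ (Set.Icc (-r) r)) (lam : ℝ)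
    {ε : ℝ} (hε : 0 < ε) (hεr : ε ≤ r) :
    truncated r ψ lam ε = oddOsc (fun t => lam * ψ t) ε r := by
  have hpos : ∀ t ∈ Set.uIcc ε r, 0 < t := fun t ht => by
    rw [Set.uIcc_of_le hεr] at ht; exact hε.trans_le ht.1
  have hI : ∀ χ : ℝ → ℝ, ContinuousOn χ (Set.uIcc ε r) → IntervalIntegrable
      (fun t : ℝ => Complex.exp (Complex.I * (χ t : ℝ)) / (t : ℂ)) volume ε r := fun χ hχ => by
    refine ContinuousOn.intervalIntegrable (ContinuousOn.div (Complex.continuous_exp.comp_continuousOn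
      (continuousOn_const.mul (Complex.continuous_ofReal.comp_continuousOn hχ)))
      Complex.continuous_ofReal.continuousOn fun t ht => ?_)
    exact_mod_cast (hpos t ht).ne'
  have h1 := hI (fun t => lam * ψ t) (continuousOn_const.mul (hψ.mono fun t ht => by
    rw [Set.uIcc_of_le hεr] at ht; exact ⟨by linarith [ht.1, ht.2], ht.2⟩))
  have h2 := hI (fun t => lam * ψ (-t)) (continuousOn_const.mul (hψ.comp
    continuous_neg.continuousOn fun t ht => by
      rw [Set.uIcc_of_le hεr] at ht; exact ⟨by linarith [ht.2], by linarith [ht.1, ht.2]⟩))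
  unfold truncated oddOsc
  simp only [sub_div]
  rw [intervalIntegral.integral_sub h1 h2, ← intervalIntegral.integral_comp_neg, add_comm,
    sub_eq_add_neg, ← intervalIntegral.integral_neg]
  simp [div_neg]

theorem MemDenjoyCarleman.exists_lipschitz {M : ℕ → ℝ} {r : ℝ} {ψ : ℝ → ℝ}
    (h : MemDenjoyCarleman M r ψ) : ∃ C : ℝ, ∀ x ∈ Set.Icc (-r) r, ∀ y ∈ Set.Icc (-r) r,
      |ψ y - ψ x| ≤ C * |y - x| := by
  obtain ⟨hψ, K, -, hK⟩ := h
  refine ⟨K ^ 2 * M 1, fun x hx y hy => ?_⟩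
  refine (convex_Icc (-r) r).norm_image_sub_le_of_norm_derivWithin_le
    (hψ.differentiableOn (by simp)) (fun t ht => ?_) hx hy
  have := hK 1 t ht
  rwa [iteratedDerivWithin_one] at this

/-- The phase is Lipschitz, so the symmetrised integrand is bounded near 0 and the principal value
is an ordinary integral over `(0, r]`. -/
theorem MemDenjoyCarleman.hasPV {M : ℕ → ℝ} {r : ℝ} {ψ : ℝ → ℝ} (hr : 0 < r)
    (h : MemDenjoyCarleman M r ψ) (lam : ℝ) : HasPV r ψ lam (m r ψ lam) := by
  refine tendsto_nhds_limUnder ?_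
  obtain ⟨C, hC⟩ := h.exists_lipschitz
  have hcont := h.1.continuousOn
  set F : ℝ → ℂ := fun t => (Complex.exp (Complex.I * (lam * ψ t : ℝ)) -
    Complex.exp (Complex.I * (lam * ψ (-t) : ℝ))) / (t : ℂ) with hF
  have hFc : ContinuousOn F (Set.Ioc 0 r) :=
    continuousOn_oddOsc_integrand (φ := fun t => lam * ψ t) (continuousOn_const.mul hcont)
  have hFI : IntegrableOn F (Set.Ioc 0 r) := by
    refine IntegrableOn.of_bound (by simp)
      (hFc.aestronglyMeasurable measurableSet_Ioc) (|lam| * (C * 2)) ?_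
    filter_upwards [ae_restrict_mem measurableSet_Ioc] with t ht
    rw [hF, norm_div, Complex.norm_real, Real.norm_of_nonneg ht.1.le, div_le_iff₀ ht.1]
    refine (norm_cexp_sub_cexp_le _ _).trans ?_
    rw [← mul_sub, abs_mul, mul_assoc]
    refine mul_le_mul_of_nonneg_left ?_ (abs_nonneg _)
    have := hC (-t) ⟨by linarith [ht.2], by linarith [ht.1]⟩ t ⟨by linarith [ht.1], ht.2⟩
    rwa [sub_neg_eq_add, ← two_mul, abs_of_pos (by linarith [ht.1] : 0 < 2 * t), ← mul_assoc] at this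
  have hprim : ContinuousOn (fun x => ∫ t in x..r, F t) (Set.uIcc 0 r) := by
    refine intervalIntegral.continuousOn_primitive_interval_left ?_
    rwa [Set.uIcc_of_le hr.le, integrableOn_Icc_iff_integrableOn_Ioc]
  refine ⟨∫ t in (0)..r, F t, ?_⟩
  have h0 : Tendsto (fun x => ∫ t in x..r, F t) (𝓝[>] 0) (𝓝 (∫ t in (0)..r, F t)) := by
    have h1 := hprim 0 (by simp)
    rw [Set.uIcc_of_le hr.le] at h1
    refine Tendsto.mono_left h1 ?_
    rw [← nhdsWithin_Ioc_eq_nhdsGT hr]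
    exact nhdsWithin_mono _ Set.Ioc_subset_Icc_self
  refine h0.congr' ?_
  filter_upwards [Ioc_mem_nhdsGT hr] with ε hε
  exact (truncated_eq_oddOsc hcont lam hε.1 hε.2).symm

theorem HasPV.norm_sub_le {r lam : ℝ} {ψ : ℝ → ℝ} {z w : ℂ} {B δ : ℝ} (h : HasPV r ψ lam z)
    (hδ : 0 < δ) (hB : ∀ ε, 0 < ε → ε ≤ δ → ‖truncated r ψ lam ε - w‖ ≤ B) : ‖z - w‖ ≤ B := by
  refine le_of_tendsto ((h.sub_const w).norm) ?_
  filter_upwards [Ioc_mem_nhdsGT hδ] with ε hε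
  exact hB ε hε.1 hε.2

/-! ### The upper bound -/

theorem exists_antiderivative (Q : ℝ[X]) (y : ℝ) : ∃ P : ℝ[X], derivative P = Q ∧ P.eval 0 = y ∧
    P.natDegree ≤ Q.natDegree + 1 := by
  refine ⟨C y + ∑ i ∈ Finset.range (Q.natDegree + 1), monomial (i + 1) (Q.coeff i / (i + 1)),
    ?_, ?_, ?_⟩
  · conv_rhs => rw [Q.as_sum_range]
    rw [derivative_add, derivative_C, zero_add, derivative_sum]
    refine Finset.sum_congr rfl fun i _ => ?_
    rw [derivative_monomial, Nat.add_sub_cancel]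
    congr 1
    push_cast
    field_simp
  · simp [eval_finsetSum]
  · refine (natDegree_add_le _ _).trans (max_le (by simp) ?_)
    refine natDegree_sum_le_of_forall_le _ _ fun j hj => (natDegree_monomial_le _).trans ?_
    have := Finset.mem_range.1 hj
    omega

/-- Taylor's formula obtained by integrating an approximation of the derivative `n` times. The
factorial gain is discarded, since it would not change the order of the final bound. -/
theorem exists_polynomial_approx {r : ℝ} (hr : 0 < r) {B : ℝ} (n : ℕ) : ∀ f : ℝ → ℝ,
    ContDiffOn ℝ ∞ f (Set.Icc (-r) r) →
    (∀ t ∈ Set.Icc (-r) r, |iteratedDerivWithin n f (Set.Icc (-r) r) t| ≤ B) →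
    ∃ P : ℝ[X], P.natDegree ≤ n ∧ ∀ t ∈ Set.Icc (-r) r, |f t - P.eval t| ≤ B * |t| ^ n := by
  induction n with
  | zero =>
    intro f _ hB
    refine ⟨0, by simp, fun t ht => ?_⟩
    simpa using hB t ht
  | succ n ih =>
    intro f hf hB
    have hu : UniqueDiffOn ℝ (Set.Icc (-r) r) := uniqueDiffOn_Icc (by linarith)
    obtain ⟨Q, hQn, hQ⟩ := ih (derivWithin f (Set.Icc (-r) r))
      (hf.derivWithin hu (by simp)) fun t ht => by
        rw [← iteratedDerivWithin_succ']; exact hB t ht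
    obtain ⟨P, hPd, hP0, hPn⟩ := exists_antiderivative Q (f 0)
    refine ⟨P, by omega, fun t ht => ?_⟩
    have hsub : Set.Icc (-|t|) |t| ⊆ Set.Icc (-r) r :=
      Set.Icc_subset_Icc (neg_le_neg (abs_le.2 ht)) (abs_le.2 ht)
    have hB0 : 0 ≤ B := (abs_nonneg _).trans (hB t ht)
    have hd : ∀ x ∈ Set.Icc (-|t|) |t|, HasDerivWithinAt (fun x => f x - P.eval x)
        (derivWithin f (Set.Icc (-r) r) x - Q.eval x) (Set.Icc (-|t|) |t|) x := fun x hx => by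
      have h1 := ((hf.differentiableOn (by simp)) x (hsub hx)).hasDerivWithinAt.mono hsub
      have h2 := (P.hasDerivAt x).hasDerivWithinAt (s := Set.Icc (-|t|) |t|)
      rw [hPd] at h2
      exact h1.sub h2
    -- The mean value inequality is applied on `[-|t|, |t|]` only, where the inductive error is at
    -- most `B|t|^n`.
    have hle := (convex_Icc (-|t|) |t|).norm_image_sub_le_of_norm_hasDerivWithin_le hd
      (C := B * |t| ^ n) (fun x hx => (hQ x (hsub hx)).trans (by
        exact mul_le_mul_of_nonneg_left
          (pow_le_pow_left₀ (abs_nonneg x) (abs_le.2 hx) n) hB0)) (x := 0) (y := t) (by simp) (by simp [neg_abs_le, le_abs_self])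
    simp only [hP0, sub_self, sub_zero, Real.norm_eq_abs] at hle
    rwa [pow_succ, ← mul_assoc]

/-- Near the origin the phase is replaced by a polynomial, away from it the integral is estimated
trivially. -/
theorem norm_oddOsc_le_of_iteratedDerivWithin_le {ψ : ℝ → ℝ}
    (hψ : ContDiffOn ℝ ∞ ψ (Set.Icc (-1) 1)) {n : ℕ} (hn : 0 < n) {lam D : ℝ} (hlam : 0 < lam)
    (hD : 0 ≤ D) (hB : ∀ t ∈ Set.Icc (-1 : ℝ) 1,
      |iteratedDerivWithin n ψ (Set.Icc (-1) 1) t| ≤ Real.exp D / lam)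
    {ε : ℝ} (hε : 0 < ε) (hεδ : ε ≤ Real.exp (-(D / n))) :
    ‖oddOsc (fun t => lam * ψ t) ε 1‖ ≤
      2 + (Nat.log 2 n + 1) * polynomialConst + 2 * (D / n) := by
  have hnR : (0 : ℝ) < n := by exact_mod_cast hn
  have hn1 : (1 : ℝ) ≤ n := by exact_mod_cast hn
  -- The radius at which `lam` times the Taylor error, `e^D |t|^n`, reaches 1.
  set δ := Real.exp (-(D / n)) with hδ
  have hδ0 : 0 < δ := Real.exp_pos _
  have hδ1 : δ ≤ 1 := Real.exp_le_one_iff.2 (by rw [neg_nonpos]; positivity)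
  have hδn : Real.exp D = (δ ^ n)⁻¹ := by
    rw [hδ, ← Real.exp_nat_mul, ← Real.exp_neg]
    congr 1
    field_simp
  obtain ⟨P, hPn, hP⟩ := exists_polynomial_approx zero_lt_one n ψ hψ hB
  have hc : ContinuousOn (fun t => lam * ψ t) (Set.Icc (-1) 1) :=
    continuousOn_const.mul hψ.continuousOn
  have hnear : ‖oddOsc (fun t => lam * ψ t) ε δ - oddOsc (fun t => (C lam * P).eval t) ε δ‖ ≤ 2 := by
    refine (norm_oddOsc_sub_le hc (C lam * P).continuous.continuousOn hε hεδ hδ1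
      (g := fun t => t ^ (n - 1) / δ ^ n) (fun t ht => ?_) (by fun_prop)).trans ?_
    · have h1 := hP t (abs_le.1 (ht.trans hδ1))
      rw [eval_mul, eval_C, ← mul_sub, abs_mul, abs_of_pos hlam, mul_div_assoc',
        mul_pow_sub_one hn.ne']
      calc lam * |ψ t - P.eval t| ≤ lam * (Real.exp D / lam * |t| ^ n) := by gcongr
        _ = |t| ^ n / δ ^ n := by rw [hδn]; field_simp
    · rw [intervalIntegral.integral_div, integral_pow, Nat.sub_add_cancel hn, Nat.cast_pred hn,
        sub_add_cancel, div_div]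
      have : (δ ^ n - ε ^ n) / (n * δ ^ n) ≤ 1 := by
        rw [div_le_one (by positivity)]
        have h1 : 0 < ε ^ n := by positivity
        have h2 : 0 < δ ^ n := by positivity
        nlinarith
      linarith
  have hpoly := norm_oddOsc_polynomial_le (Nat.log 2 n + 1) (C lam * P)
    (((natDegree_C_mul_le _ _).trans hPn).trans_lt (Nat.lt_pow_succ_log_self (by norm_num) n))
    ε δ hε hεδ
  have hfar := norm_oddOsc_le_log (φ := fun t => lam * ψ t) hδ0 hδ1
  have hlog : Real.log (1 / δ) = D / n := by
    rw [one_div, Real.log_inv, hδ, Real.log_exp, neg_neg]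
  rw [hlog] at hfar
  rw [← oddOsc_add hc hε hεδ hδ1 le_rfl]
  refine (norm_add_le _ _).trans ?_
  have h3 := norm_le_norm_add_norm_sub' (oddOsc (fun t => lam * ψ t) ε δ)
    (oddOsc (fun t => (C lam * P).eval t) ε δ)
  push_cast at hpoly
  linarith

theorem isBigO_m_of_memDenjoyCarleman {α c : ℝ} (hα : 1 < α) (hc : 0 < c) {ψ : ℝ → ℝ}
    (h : MemDenjoyCarleman (weight c α) 1 ψ) :
    (fun lam : ℝ => m 1 ψ lam) =O[atTop] (fun lam : ℝ => (Real.log lam) ^ (1 - 1 / α)) := by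
  obtain ⟨hψ, K₀, hK₀, hbound₀⟩ := id h
  -- Enlarging the constant to at least 1 makes `log K`, and hence `D`, nonnegative.
  obtain ⟨K, hK1, hbound⟩ : ∃ K : ℝ, 1 ≤ K ∧ ∀ n : ℕ, ∀ t ∈ Set.Icc (-1 : ℝ) 1,
      |iteratedDerivWithin n ψ (Set.Icc (-1) 1) t| ≤ K ^ (n + 1) * weight c α n := by
    refine ⟨max K₀ 1, le_max_right _ _, fun n t ht => (hbound₀ n t ht).trans ?_⟩
    have : 0 ≤ weight c α n := (Real.exp_pos _).le
    gcongr
    exact le_max_left _ _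
  have hα0 : 0 < α := by linarith
  have hα1 : 0 < α - 1 := by linarith
  have hpC := polynomialConst_nonneg
  set A : ℝ := 2 + (2 * (2 ^ (α - 1) / (α - 1)) + 1) * polynomialConst +
    2 * (1 + 2 * Real.log K + c * 2 ^ (α - 1)) with hA
  refine IsBigO.of_bound A ?_
  filter_upwards [eventually_ge_atTop (Real.exp 1)] with lam hlam
  have hlam0 : 0 < lam := (Real.exp_pos 1).trans_le hlam
  set L := Real.log lam with hL
  have hL1 : 1 ≤ L := by rw [hL, Real.le_log_iff_exp_le hlam0]; exact hlam
  have hL0 : 0 < L := by linarith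
  -- The order of the Taylor polynomial that equalises `L/n` and `n^{α-1}`.
  set x : ℝ := L ^ (1 / α) with hx
  have hx1 : 1 ≤ x := Real.one_le_rpow hL1 (by positivity)
  set n := ⌈x⌉₊ with hn
  have hxn : x ≤ n := Nat.le_ceil x
  have hn1 : (1 : ℝ) ≤ n := hx1.trans hxn
  have hn0 : 0 < n := by exact_mod_cast (by linarith : (0 : ℝ) < n)
  have hnR : (0 : ℝ) < n := by linarith
  have hn2 : (n : ℝ) ≤ 2 * x := by
    have := Nat.ceil_lt_add_one (by linarith : 0 ≤ x)
    linarith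
  set Y : ℝ := L ^ (1 - 1 / α) with hY
  have hY1 : 1 ≤ Y := Real.one_le_rpow hL1 (by
    rw [sub_nonneg, div_le_one hα0]; exact hα.le)
  have hxY : x * Y = L := by
    rw [hx, hY, ← Real.rpow_add hL0]; simp
  have hYx : x ^ (α - 1) = Y := by
    rw [hx, hY, ← Real.rpow_mul hL0.le]; congr 1; field_simp
  have hnpow : (n : ℝ) ^ (α - 1) ≤ 2 ^ (α - 1) * Y := by
    calc (n : ℝ) ^ (α - 1) ≤ (2 * x) ^ (α - 1) := Real.rpow_le_rpow hnR.le hn2 hα1.le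
      _ = 2 ^ (α - 1) * Y := by rw [Real.mul_rpow (by norm_num) (by linarith), hYx]
  set D : ℝ := L + (n + 1) * Real.log K + c * (n : ℝ) ^ α with hD
  have hlogK : 0 ≤ Real.log K := Real.log_nonneg hK1
  have hD0 : 0 ≤ D := by positivity
  have hexpD : Real.exp D / lam = K ^ (n + 1) * weight c α n := by
    have e1 : Real.exp ((n + 1) * Real.log K) = K ^ (n + 1) := by
      rw [← Real.exp_log (by linarith : 0 < K), ← Real.exp_nat_mul, Real.log_exp]; push_cast; rfl
    rw [hD, Real.exp_add, Real.exp_add, e1, hL, Real.exp_log hlam0, weight]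
    field_simp
  have hDn : D / n ≤ (1 + 2 * Real.log K + c * 2 ^ (α - 1)) * Y := by
    have h1 : L / n ≤ Y := by
      rw [div_le_iff₀ hnR, ← hxY, mul_comm]; gcongr
    have h2 : (n + 1) * Real.log K / n ≤ 2 * Real.log K * Y := by
      rw [div_le_iff₀ hnR]
      have : (n + 1 : ℝ) ≤ 2 * n * Y := by nlinarith
      calc (n + 1) * Real.log K ≤ 2 * n * Y * Real.log K := by gcongr
        _ = _ := by ring
    have h3 : c * (n : ℝ) ^ α / n ≤ c * 2 ^ (α - 1) * Y := by
      rw [mul_div_assoc, ← Real.rpow_sub_one hnR.ne', mul_assoc]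
      gcongr
    rw [hD, add_div, add_div]
    linarith
  -- The cost of the polynomial phase is absorbed because the logarithm grows more slowly than the
  -- positive power `n^{α-1}`.
  have hlogn : (Nat.log 2 n : ℝ) ≤ 2 * (2 ^ (α - 1) / (α - 1)) * Y := by
    have h1 : (Nat.log 2 n : ℝ) ≤ Real.logb 2 n := Real.natLog_le_logb n 2
    have h2 : Real.logb 2 n ≤ 2 * Real.log n := by
      rw [Real.logb, div_le_iff₀ (by positivity)]
      have := Real.log_two_gt_d9
      have := Real.log_nonneg hn1
      nlinarith
    have h3 : Real.log n ≤ (n : ℝ) ^ (α - 1) / (α - 1) := Real.log_le_rpow_div hnR.le hα1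
    have h4 : (n : ℝ) ^ (α - 1) / (α - 1) ≤ 2 ^ (α - 1) * Y / (α - 1) := by gcongr
    calc (Nat.log 2 n : ℝ) ≤ 2 * (2 ^ (α - 1) * Y / (α - 1)) := by linarith
      _ = _ := by ring
  have hmain : ‖m 1 ψ lam - 0‖ ≤ 2 + (Nat.log 2 n + 1) * polynomialConst + 2 * (D / n) := by
    refine (h.hasPV zero_lt_one lam).norm_sub_le (δ := Real.exp (-(D / n))) (Real.exp_pos _)
      fun ε hε hεδ => ?_
    have hδ1 : Real.exp (-(D / n)) ≤ 1 :=
      Real.exp_le_one_iff.2 (by rw [neg_nonpos]; positivity)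
    rw [sub_zero, truncated_eq_oddOsc hψ.continuousOn lam hε (hεδ.trans hδ1)]
    exact norm_oddOsc_le_of_iteratedDerivWithin_le hψ hn0 hlam0 hD0
      (fun t ht => by rw [hexpD]; exact hbound n t ht) hε hεδ
  rw [sub_zero] at hmain
  rw [Real.norm_of_nonneg (by linarith : 0 ≤ Y), hA]
  have h5 : (Nat.log 2 n + 1) * polynomialConst ≤
      (2 * (2 ^ (α - 1) / (α - 1)) * Y + Y) * polynomialConst := by gcongr
  nlinarith

end PolynomialPhase

/-! ### The flat phases and their derivatives -/

/-- The phase `exp(-A (b - log t)^β)` for `t > 0`, extended by `0`. -/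
def flatPhase (A β b t : ℝ) : ℝ :=
  if t ≤ 0 then 0 else Real.exp (-(A * (b - Real.log t) ^ β))

/-- The holomorphic continuation of `flatPhase` from the positive axis. -/
def complexPhase (A β b : ℝ) (z : ℂ) : ℂ :=
  Complex.exp (-((A : ℂ) * ((b : ℂ) - Complex.log z) ^ (β : ℂ)))

/-- A half disc on which `complexPhase` is holomorphic. -/
def halfDisc (b : ℝ) : Set ℂ := {z | 0 < z.re ∧ ‖z‖ < Real.exp b}

theorem isOpen_halfDisc (b : ℝ) : IsOpen (halfDisc b) :=
  (isOpen_lt continuous_const Complex.continuous_re).inter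
    (isOpen_lt continuous_norm continuous_const)

theorem ofReal_mem_halfDisc {b t : ℝ} (h0 : 0 < t) (h1 : t < Real.exp b) :
    (t : ℂ) ∈ halfDisc b := by
  refine ⟨by simpa using h0, ?_⟩
  rwa [Complex.norm_real, Real.norm_of_nonneg h0.le]

theorem differentiableOn_complexPhase (A β b : ℝ) :
    DifferentiableOn ℂ (complexPhase A β b) (halfDisc b) := fun z hz => by
  have hz0 : 0 < ‖z‖ := norm_pos_iff.2 fun h => by
    have := hz.1
    simp [h] at this
  have h1 : DifferentiableAt ℂ (fun z => (b : ℂ) - Complex.log z) z :=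
    (differentiableAt_const _).sub (Complex.differentiableAt_log (Or.inl hz.1))
  have h2 : (b : ℂ) - Complex.log z ∈ Complex.slitPlane := by
    left
    rw [Complex.sub_re, Complex.ofReal_re, Complex.log_re, sub_pos, Real.log_lt_iff_lt_exp hz0]
    exact hz.2
  exact ((((differentiableAt_const _).mul (h1.cpow_const h2)).neg).cexp).differentiableWithinAt

theorem complexPhase_ofReal {A β b t : ℝ} (h0 : 0 < t) (h1 : t < Real.exp b) :
    complexPhase A β b t = (flatPhase A β b t : ℂ) := by
  have hb : 0 ≤ b - Real.log t := by
    rw [sub_nonneg]; exact ((Real.log_lt_iff_lt_exp h0).2 h1).le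
  rw [flatPhase, if_neg (not_le.2 h0), complexPhase, ← Complex.ofReal_log h0.le,
    ← Complex.ofReal_sub, ← Complex.ofReal_cpow hb]
  push_cast
  rfl

/-- The radius, relative to the centre, of the discs in the Cauchy estimates. -/
def cauchyRatio (β : ℝ) : ℝ := 1 / (β * 2 ^ (β + 1))

theorem cauchyRatio_pos {β : ℝ} (hβ : 1 < β) : 0 < cauchyRatio β := by
  unfold cauchyRatio; positivity

theorem cauchyRatio_le {β : ℝ} (hβ : 1 < β) : cauchyRatio β ≤ 1 / 4 := by
  unfold cauchyRatio
  have h : (4 : ℝ) ≤ 2 ^ (β + 1) := by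
    calc (4 : ℝ) = 2 ^ (2 : ℝ) := by norm_num
      _ ≤ _ := Real.rpow_le_rpow_of_exponent_le (by norm_num) (by linarith)
  exact one_div_le_one_div_of_le (by norm_num) (by nlinarith)

/-- On the disc the derivative of `s^β` is at most `β(2l)^{β-1}`. The value of `cauchyRatio` makes
the displacement at most `(3/8) l^{β-1}`, less than half of `l^β`. -/
theorem half_rpow_le_re_cpow {β : ℝ} (hβ : 1 < β) {l : ℝ} (hl : 1 ≤ l) {η : ℂ}
    (hη : ‖η‖ ≤ 3 / 2 * cauchyRatio β) : l ^ β / 2 ≤ (((l : ℂ) - η) ^ (β : ℂ)).re := by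
  have hβ0 : 0 < β := by linarith
  have hl0 : 0 < l := by linarith
  have hη1 : ‖η‖ ≤ 3 / 8 := by linarith [cauchyRatio_le hβ]
  have hd : ∀ s ∈ Metric.closedBall (l : ℂ) ‖η‖, HasDerivWithinAt (fun s : ℂ => s ^ (β : ℂ))
      ((β : ℂ) * s ^ ((β : ℂ) - 1)) (Metric.closedBall (l : ℂ) ‖η‖) s := fun s hs => by
    refine (Complex.hasStrictDerivAt_cpow_const (Or.inl ?_)).hasDerivAt.hasDerivWithinAt
    rw [mem_closedBall_iff_norm] at hs
    have := (Complex.abs_re_le_norm (s - l)).trans hs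
    rw [Complex.sub_re, Complex.ofReal_re, abs_le] at this
    linarith
  have hb : ∀ s ∈ Metric.closedBall (l : ℂ) ‖η‖,
      ‖(β : ℂ) * s ^ ((β : ℂ) - 1)‖ ≤ β * (2 * l) ^ (β - 1) := fun s hs => by
    have e : (β : ℂ) - 1 = ((β - 1 : ℝ) : ℂ) := by push_cast; rfl
    rw [norm_mul, Complex.norm_real, Real.norm_of_nonneg hβ0.le, e, Complex.norm_cpow_real]
    gcongr
    rw [mem_closedBall_iff_norm] at hs
    have := norm_le_norm_add_norm_sub' s (l : ℂ)
    rw [Complex.norm_real, Real.norm_of_nonneg hl0.le] at this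
    linarith
  have hmv := (convex_closedBall (l : ℂ) ‖η‖).norm_image_sub_le_of_norm_hasDerivWithin_le hd hb
    (x := (l : ℂ)) (y := (l : ℂ) - η) (by simp) (by simp)
  have hle : β * (2 * l) ^ (β - 1) * ‖η‖ ≤ l ^ β / 2 := by
    have h1 : (2 * l) ^ (β - 1) = 2 ^ (β + 1) / 4 * l ^ (β - 1) := by
      rw [Real.mul_rpow (by norm_num) hl0.le]
      congr 1
      have : β + 1 = (β - 1) + 2 := by ring
      rw [this, Real.rpow_add (by norm_num)]
      norm_num
    have h2 : l ^ (β - 1) ≤ l ^ β := Real.rpow_le_rpow_of_exponent_le hl (by linarith)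
    have h3 : β * (2 * l) ^ (β - 1) * (3 / 2 * cauchyRatio β) = 3 / 8 * l ^ (β - 1) := by
      rw [h1, cauchyRatio]
      field_simp
      norm_num
    have h4 : 0 < l ^ β := by positivity
    calc _ ≤ β * (2 * l) ^ (β - 1) * (3 / 2 * cauchyRatio β) := by gcongr
      _ ≤ _ := by rw [h3]; linarith
  have hsub : ((l : ℂ) - η) - l = -η := by ring
  rw [hsub, norm_neg, ← Complex.ofReal_cpow hl0.le] at hmv
  have := (Complex.abs_re_le_norm _).trans (hmv.trans hle)
  rw [Complex.sub_re, Complex.ofReal_re, abs_le] at this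
  linarith

/-- With `z = t(1 + ζ)`, `log z` differs from `log t` by `log(1 + ζ)`, of size at most `3/2 ‖ζ‖`. A
relative disc about `t` thus stays in a fixed small disc about `b - log t`, and half the exponent is
kept. -/
theorem norm_complexPhase_le {A β b t : ℝ} (hA : 0 < A) (hβ : 1 < β) (ht : 0 < t)
    (htb : t ≤ Real.exp (b - 1)) {z : ℂ} (hz : ‖z - t‖ ≤ cauchyRatio β * t) :
    ‖complexPhase A β b z‖ ≤ Real.exp (-(A / 2 * (b - Real.log t) ^ β)) := by
  have hl : 1 ≤ b - Real.log t := by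
    have := (Real.log_le_iff_le_exp ht).2 htb
    linarith
  have htC : (t : ℂ) ≠ 0 := by exact_mod_cast ht.ne'
  set ζ : ℂ := (z - t) / t with hζ
  have hζn : ‖ζ‖ ≤ cauchyRatio β := by
    rw [hζ, norm_div, Complex.norm_real, Real.norm_of_nonneg ht.le, div_le_iff₀ ht]
    exact hz
  have hζ4 : ‖ζ‖ ≤ 1 / 4 := hζn.trans (cauchyRatio_le hβ)
  have hz1 : z = t * (1 + ζ) := by rw [hζ]; field_simp; ring
  have h10 : 1 + ζ ≠ 0 := fun h => by
    have : ζ = -1 := by linear_combination h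
    rw [this, norm_neg, norm_one] at hζ4
    norm_num at hζ4
  have hlog : (b : ℂ) - Complex.log z = ((b - Real.log t : ℝ) : ℂ) - Complex.log (1 + ζ) := by
    rw [hz1, Complex.log_ofReal_mul ht h10]; push_cast; ring
  have hη : ‖Complex.log (1 + ζ)‖ ≤ 3 / 2 * cauchyRatio β :=
    (Complex.norm_log_one_add_half_le_self (hζ4.trans (by norm_num))).trans (by gcongr)
  have := half_rpow_le_re_cpow hβ hl hη
  rw [complexPhase, Complex.norm_exp, hlog, Complex.neg_re, Complex.re_ofReal_mul]
  refine Real.exp_le_exp.2 (neg_le_neg ?_)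
  nlinarith

theorem norm_iteratedDeriv_complexPhase_le {A β b t : ℝ} (hA : 0 < A) (hβ : 1 < β) (ht : 0 < t)
    (htb : t ≤ Real.exp (b - 1)) (n : ℕ) :
    ‖iteratedDeriv n (complexPhase A β b) t‖ ≤
      n.factorial * Real.exp (-(A / 2 * (b - Real.log t) ^ β)) / (cauchyRatio β * t) ^ n := by
  have hκ := cauchyRatio_pos hβ
  have hκ4 := cauchyRatio_le hβ
  refine Complex.norm_iteratedDeriv_le_of_forall_mem_sphere_norm_le n (by positivity)
    ((differentiableOn_complexPhase A β b).diffContOnCl_ball fun z hz => ?_) fun z hz => ?_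
  · rw [mem_closedBall_iff_norm] at hz
    have h4 : ‖z - t‖ ≤ t / 4 := hz.trans (by nlinarith)
    constructor
    · have := (Complex.abs_re_le_norm (z - t)).trans h4
      rw [Complex.sub_re, Complex.ofReal_re, abs_le] at this
      linarith
    · have h1 := norm_le_norm_add_norm_sub' z (t : ℂ)
      rw [Complex.norm_real, Real.norm_of_nonneg ht.le] at h1
      have h2 : Real.exp b = Real.exp (b - 1) * Real.exp 1 := by rw [← Real.exp_add]; ring_nf
      have h3 := Real.exp_one_gt_d9
      have h5 := Real.exp_pos (b - 1)
      nlinarith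
  · rw [mem_sphere_iff_norm] at hz
    exact norm_complexPhase_le hA hβ ht htb hz.le

/-- With `l = b - log t` one has `t^{-k} = e^{k(l-b)}`. Young's inequality for `(k/τ)(τl)` splits
`kl` into a multiple of `k^α` and a multiple of `l^β` that the flat factor absorbs. -/
theorem exp_neg_div_pow_le {α β A b τ t : ℝ} (hαβ : α.HolderConjugate β) (hτ : 0 < τ)
    (hτA : τ ^ β / β ≤ A / 2) (ht : 0 < t) (htb : t ≤ Real.exp (b - 1)) (k : ℕ) :
    Real.exp (-(A / 2 * (b - Real.log t) ^ β)) / t ^ k ≤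
      Real.exp (τ ^ (-α) / α * (k : ℝ) ^ α - k * b) := by
  have hl : 1 ≤ b - Real.log t := by
    have := (Real.log_le_iff_le_exp ht).2 htb
    linarith
  set l := b - Real.log t with hldef
  have hl0 : 0 < l := by linarith
  have hpow : t ^ k = Real.exp (k * (b - l)) := by
    rw [hldef, sub_sub_cancel, Real.exp_nat_mul, Real.exp_log ht]
  rw [hpow, ← Real.exp_sub]
  refine Real.exp_le_exp.2 ?_
  have hy := Real.young_inequality (k / τ) (τ * l) hαβ
  rw [abs_of_nonneg (by positivity), abs_of_pos (by positivity),
    Real.div_rpow (by positivity) hτ.le, Real.mul_rpow hτ.le hl0.le] at hy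
  have e1 : (k : ℝ) / τ * (τ * l) = k * l := by field_simp
  have e2 : (k : ℝ) ^ α / τ ^ α / α = τ ^ (-α) / α * (k : ℝ) ^ α := by
    rw [Real.rpow_neg hτ.le]; ring
  have e3 : τ ^ β * l ^ β / β ≤ A / 2 * l ^ β := by
    calc _ = τ ^ β / β * l ^ β := by ring
      _ ≤ _ := by gcongr
  rw [e1, e2] at hy
  linarith

/-- The candidate for the `n`-th derivative of `flatPhase`. -/
def flatPhaseDeriv (A β b : ℝ) (n : ℕ) (t : ℝ) : ℝ :=
  if t ≤ 0 then 0 else (iteratedDeriv n (complexPhase A β b) t).re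

/-- A power `|t|^k` is gained by spending `k` more powers of `1/t`. The case `k = 0` gives the class
bound, and `k = 2` gives differentiability at the origin. -/
theorem abs_flatPhaseDeriv_le {α β A b τ t : ℝ} (hαβ : α.HolderConjugate β) (hA : 0 < A)
    (hτ : 0 < τ) (hτA : τ ^ β / β ≤ A / 2) (htb : t ≤ Real.exp (b - 1)) (n k : ℕ) :
    |flatPhaseDeriv A β b n t| ≤ n.factorial / cauchyRatio β ^ n *
      Real.exp (τ ^ (-α) / α * ((n + k : ℕ) : ℝ) ^ α - (n + k : ℕ) * b) * |t| ^ k := by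
  have hκ := cauchyRatio_pos hαβ.symm.lt
  unfold flatPhaseDeriv
  split_ifs with h
  · rw [abs_zero]; positivity
  · rw [not_le] at h
    refine (Complex.abs_re_le_norm _).trans
      ((norm_iteratedDeriv_complexPhase_le hA hαβ.symm.lt h htb n).trans ?_)
    have h1 := exp_neg_div_pow_le hαβ hτ hτA h htb (n + k)
    rw [abs_of_pos h]
    calc _ = n.factorial / cauchyRatio β ^ n *
          (Real.exp (-(A / 2 * (b - Real.log t) ^ β)) / t ^ (n + k)) * t ^ k := by
          rw [mul_pow, pow_add]; field_simp
      _ ≤ _ := by gcongr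

theorem hasDerivAt_flatPhaseDeriv {α β A b : ℝ} (hαβ : α.HolderConjugate β) (hA : 0 < A) (n : ℕ)
    {t : ℝ} (ht : t < Real.exp b) :
    HasDerivAt (flatPhaseDeriv A β b n) (flatPhaseDeriv A β b (n + 1) t) t := by
  rcases lt_trichotomy t 0 with h | rfl | h
  · have hv : flatPhaseDeriv A β b (n + 1) t = 0 := if_pos h.le
    rw [hv]
    refine (hasDerivAt_const t (0 : ℝ)).congr_of_eventuallyEq ?_
    filter_upwards [Iio_mem_nhds h] with s hs
    exact if_pos (le_of_lt hs)
  · have hv : flatPhaseDeriv A β b (n + 1) 0 = 0 := if_pos le_rfl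
    rw [hv]
    have hβ0 : 0 < β := hαβ.symm.pos
    set τ : ℝ := (β * (A / 2)) ^ (1 / β) with hτ
    have hτ0 : 0 < τ := by positivity
    have hτA : τ ^ β / β ≤ A / 2 := by
      rw [hτ, ← Real.rpow_mul (by positivity), one_div_mul_cancel hβ0.ne', Real.rpow_one,
        mul_div_cancel_left₀ _ hβ0.ne']
    -- Quadratic decay at 0 forces a zero derivative there, matching the prescribed value of the
    -- next candidate.
    have hO : flatPhaseDeriv A β b n =O[𝓝 0] fun x => ‖x - 0‖ ^ 2 := by
      refine IsBigO.of_bound (n.factorial / cauchyRatio β ^ n *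
        Real.exp (τ ^ (-α) / α * ((n + 2 : ℕ) : ℝ) ^ α - (n + 2 : ℕ) * b)) ?_
      filter_upwards [Iio_mem_nhds (Real.exp_pos (b - 1))] with x hx
      have := abs_flatPhaseDeriv_le hαβ hA hτ0 hτA (le_of_lt hx) n 2
      rwa [sub_zero, norm_pow, norm_norm, Real.norm_eq_abs, Real.norm_eq_abs]
    simpa using (hO.hasFDerivAt one_lt_two).hasDerivAt
  · have hv : flatPhaseDeriv A β b (n + 1) t =
        (iteratedDeriv (n + 1) (complexPhase A β b) t).re := if_neg (not_le.2 h)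
    have hd : HasDerivAt (iteratedDeriv n (complexPhase A β b))
        (iteratedDeriv (n + 1) (complexPhase A β b) t) (t : ℂ) := by
      rw [iteratedDeriv_succ, hasDerivAt_deriv_iff, iteratedDeriv_eq_iterate]
      exact (((differentiableOn_complexPhase A β b).analyticOnNhd (isOpen_halfDisc b)).iterated_deriv
        n t (ofReal_mem_halfDisc h ht)).differentiableAt
    rw [hv]
    refine hd.real_of_complex.congr_of_eventuallyEq ?_
    filter_upwards [Ioi_mem_nhds h] with s hs
    exact if_neg (not_le.2 hs)

theorem contDiffOn_of_hasDerivAt_succ {s : Set ℝ} (hs : IsOpen s) {g : ℕ → ℝ → ℝ}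
    (h : ∀ n, ∀ x ∈ s, HasDerivAt (g n) (g (n + 1) x) x) : ContDiffOn ℝ ∞ (g 0) s := by
  have key : ∀ n : ℕ, ∀ k, ContDiffOn ℝ n (g k) s := by
    intro n
    induction n with
    | zero => exact fun k => contDiffOn_zero.2 fun x hx => (h k x hx).continuousAt.continuousWithinAt
    | succ n ih =>
      intro k
      push_cast
      rw [contDiffOn_succ_iff_deriv_of_isOpen hs]
      refine ⟨fun x hx => (h k x hx).differentiableAt.differentiableWithinAt, by simp, ?_⟩
      exact (ih (k + 1)).congr fun x hx => (h k x hx).deriv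
  exact contDiffOn_infty.2 fun n => key n 0

theorem iteratedDeriv_eq_of_hasDerivAt_succ {s : Set ℝ} (hs : IsOpen s) {g : ℕ → ℝ → ℝ}
    (h : ∀ n, ∀ x ∈ s, HasDerivAt (g n) (g (n + 1) x) x) (n : ℕ) :
    ∀ x ∈ s, iteratedDeriv n (g 0) x = g n x := by
  induction n with
  | zero => simp
  | succ n ih =>
    intro x hx
    rw [iteratedDeriv_succ]
    have : iteratedDeriv n (g 0) =ᶠ[𝓝 x] g n := by
      filter_upwards [hs.mem_nhds hx] with y hy using ih y hy
    rw [this.deriv_eq, (h n x hx).deriv]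

theorem exists_factorial_le {α c : ℝ} (hα : 1 < α) (hc : 0 < c) :
    ∃ C : ℝ, 0 < C ∧ ∀ n : ℕ, (n.factorial : ℝ) ≤ C ^ n * Real.exp (c * (n : ℝ) ^ α) := by
  have hα1 : 0 < α - 1 := by linarith
  -- The constant that results from `log x ≤ x - 1` at `x = c(α-1)n^{α-1}`.
  set C₁ : ℝ := -(1 + Real.log (c * (α - 1))) / (α - 1) with hC₁
  refine ⟨Real.exp C₁, Real.exp_pos _, fun n => ?_⟩
  rcases Nat.eq_zero_or_pos n with rfl | hn
  · simp [Real.zero_rpow (by linarith : α ≠ 0)]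
  have hnR : (0 : ℝ) < n := by exact_mod_cast hn
  have hlog : Real.log n ≤ c * (n : ℝ) ^ (α - 1) + C₁ := by
    have h1 := Real.log_le_sub_one_of_pos (by positivity : 0 < c * (α - 1) * (n : ℝ) ^ (α - 1))
    rw [Real.log_mul (by positivity) (by positivity), Real.log_rpow hnR] at h1
    have h2 : (α - 1) * Real.log n ≤ (α - 1) * (c * (n : ℝ) ^ (α - 1) + C₁) := by
      rw [mul_add, hC₁, mul_div_cancel₀ _ hα1.ne']
      linarith
    exact le_of_mul_le_mul_left h2 hα1
  calc (n.factorial : ℝ) ≤ (n : ℝ) ^ n := by exact_mod_cast Nat.factorial_le_pow n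
    _ = Real.exp (n * Real.log n) := by rw [Real.exp_nat_mul, Real.exp_log hnR]
    _ ≤ Real.exp (n * (c * (n : ℝ) ^ (α - 1) + C₁)) := by gcongr
    _ = Real.exp C₁ ^ n * Real.exp (c * (n : ℝ) ^ α) := by
      rw [← Real.exp_nat_mul, ← Real.exp_add]
      congr 1
      rw [Real.rpow_sub_one hnR.ne']
      field_simp
      ring

/-- Half of `c` pays for the factorial of the Cauchy estimate and half for Young's inequality; the
geometric factors go into `K`. -/
theorem memDenjoyCarleman_flatPhase {α β A b τ c : ℝ} (hαβ : α.HolderConjugate β) (hA : 0 < A)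
    (hτ : 0 < τ) (hτA : τ ^ β / β ≤ A / 2) (hc : 0 < c) (hτc : τ ^ (-α) / α ≤ c / 2) :
    MemDenjoyCarleman (weight c α) (Real.exp (b - 1)) (flatPhase A β b) := by
  have hr : 0 < Real.exp (b - 1) := Real.exp_pos _
  have hsub : Set.Icc (-Real.exp (b - 1)) (Real.exp (b - 1)) ⊆ Set.Iio (Real.exp b) := fun t ht =>
    lt_of_le_of_lt ht.2 (Real.exp_lt_exp.2 (by linarith))
  have hd : ∀ n, ∀ x ∈ Set.Iio (Real.exp b),
      HasDerivAt (flatPhaseDeriv A β b n) (flatPhaseDeriv A β b (n + 1) x) x := fun n x hx =>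
    hasDerivAt_flatPhaseDeriv hαβ hA n hx
  have hsmooth := contDiffOn_of_hasDerivAt_succ isOpen_Iio hd
  have heq : Set.EqOn (flatPhase A β b) (flatPhaseDeriv A β b 0)
      (Set.Icc (-Real.exp (b - 1)) (Real.exp (b - 1))) := fun t ht => by
    rcases le_or_gt t 0 with h | h
    · rw [flatPhase, flatPhaseDeriv, if_pos h, if_pos h]
    · rw [flatPhaseDeriv, if_neg (not_le.2 h), iteratedDeriv_zero,
        complexPhase_ofReal h (hsub ht), Complex.ofReal_re]
  refine ⟨(hsmooth.mono hsub).congr heq, ?_⟩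
  obtain ⟨C, hC, hfact⟩ := exists_factorial_le hαβ.lt (half_pos hc)
  have hκ := cauchyRatio_pos hαβ.symm.lt
  set K : ℝ := max 1 (C / cauchyRatio β * Real.exp (-b)) with hK
  refine ⟨K, lt_of_lt_of_le one_pos (le_max_left _ _), fun n t ht => ?_⟩
  rw [iteratedDerivWithin_congr heq ht, iteratedDerivWithin_eq_iteratedDeriv
    (uniqueDiffOn_Icc (by linarith)) ((hsmooth.contDiffAt (isOpen_Iio.mem_nhds (hsub ht))).of_le
      (by exact_mod_cast le_top)) ht,
    iteratedDeriv_eq_of_hasDerivAt_succ isOpen_Iio hd n t (hsub ht)]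
  refine (abs_flatPhaseDeriv_le hαβ hA hτ hτA ht.2 n 0).trans ?_
  rw [pow_zero, mul_one, add_zero]
  have hK1 : (C / cauchyRatio β * Real.exp (-b)) ^ n ≤ K ^ (n + 1) :=
    (pow_le_pow_left₀ (by positivity) (le_max_right _ _) n).trans
      (pow_le_pow_right₀ (le_max_left _ _) (Nat.le_succ n))
  calc _ ≤ C ^ n * Real.exp (c / 2 * (n : ℝ) ^ α) / cauchyRatio β ^ n *
        Real.exp (c / 2 * (n : ℝ) ^ α - n * b) := by
        gcongr
        exact hfact n
    _ = (C / cauchyRatio β * Real.exp (-b)) ^ n * weight c α n := by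
        have e1 : Real.exp (c / 2 * (n : ℝ) ^ α - n * b) =
            Real.exp (c / 2 * (n : ℝ) ^ α) * Real.exp (-b) ^ n := by
          rw [← Real.exp_nat_mul, ← Real.exp_add]; ring_nf
        have e2 : weight c α n = Real.exp (c / 2 * (n : ℝ) ^ α) * Real.exp (c / 2 * (n : ℝ) ^ α) := by
          rw [weight, ← Real.exp_add]; ring_nf
        rw [e1, e2, mul_pow, div_pow]
        ring
    _ ≤ _ := by
        gcongr
        exact (Real.exp_pos _).le

/-! ### Growth of the oscillatory integral of a flat phase -/

/-- The substitution `t = e^{b-u}` turns `dt/t` into `du` up to sign. The half-line where the phase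
vanishes supplies the constant `-1`. -/
theorem truncated_flatPhase_eq {A β b : ℝ}
    (hcont : ContinuousOn (flatPhase A β b) (Set.Icc (-Real.exp (b - 1)) (Real.exp (b - 1))))
    (lam : ℝ) {ε : ℝ} (hε : 0 < ε) (hεr : ε ≤ Real.exp (b - 1)) :
    truncated (Real.exp (b - 1)) (flatPhase A β b) lam ε =
      ∫ u in (1)..(b - Real.log ε),
        (Complex.exp (Complex.I * (lam * Real.exp (-(A * u ^ β)) : ℝ)) - 1) := by
  have hE : 1 ≤ b - Real.log ε := by
    have := (Real.log_le_iff_le_exp hε).2 hεr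
    linarith
  have hd : ∀ u ∈ Set.uIcc 1 (b - Real.log ε),
      HasDerivAt (fun u => Real.exp (b - u)) (-Real.exp (b - u)) u := fun u _ => by
    simpa using ((hasDerivAt_id u).const_sub b).exp
  have himage : (fun u => Real.exp (b - u)) '' Set.uIcc 1 (b - Real.log ε) ⊆
      Set.Ioc 0 (Real.exp (b - 1)) := by
    rintro _ ⟨u, hu, rfl⟩
    rw [Set.uIcc_of_le hE] at hu
    exact ⟨Real.exp_pos _, Real.exp_le_exp.2 (by linarith [hu.1])⟩
  have hsub := intervalIntegral.integral_deriv_smul_comp' hd (by fun_prop)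
    ((continuousOn_oddOsc_integrand (φ := fun t => lam * flatPhase A β b t)
      (continuousOn_const.mul hcont)).mono himage)
  rw [truncated_eq_oddOsc hcont lam hε hεr, oddOsc, intervalIntegral.integral_symm]
  rw [sub_sub_cancel, Real.exp_log hε] at hsub
  rw [← hsub, ← intervalIntegral.integral_neg]
  refine intervalIntegral.integral_congr fun u _ => ?_
  have hpos := Real.exp_pos (b - u)
  have h1 : flatPhase A β b (Real.exp (b - u)) = Real.exp (-(A * u ^ β)) := by
    rw [flatPhase, if_neg (not_le.2 hpos), Real.log_exp, sub_sub_cancel]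
  have h2 : flatPhase A β b (-Real.exp (b - u)) = 0 := if_pos (by linarith)
  have h0 : (Real.exp (b - u) : ℂ) ≠ 0 := by exact_mod_cast hpos.ne'
  simp only [Function.comp, h1, h2, mul_zero, Complex.ofReal_zero, Complex.exp_zero,
    Complex.real_smul, Complex.ofReal_neg]
  field_simp

/-- The exponent `A u^β` grows at least at unit rate, so beyond `U` the phase decays at least like
`e^{U-u}`. -/
theorem sub_le_mul_rpow_sub {A β U u : ℝ} (hA : 1 ≤ A) (hβ : 1 < β) (hU : 1 ≤ U) (hu : U ≤ u) :
    u - U ≤ A * u ^ β - A * U ^ β := by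
  have hU0 : 0 < U := by linarith
  have hu0 : 0 < u := by linarith
  have h1 : 1 ≤ U ^ (β - 1) := Real.one_le_rpow hU (by linarith)
  have h2 : U ^ (β - 1) ≤ u ^ (β - 1) := Real.rpow_le_rpow hU0.le hu (by linarith)
  have e1 : U ^ β = U ^ (β - 1) * U := by rw [Real.rpow_sub_one hU0.ne']; field_simp
  have e2 : u ^ β = u ^ (β - 1) * u := by rw [Real.rpow_sub_one hu0.ne']; field_simp
  have h3 : u - U ≤ u ^ β - U ^ β := by rw [e1, e2]; nlinarith
  nlinarith

theorem continuousOn_cexp_phase (A β lam : ℝ) {a b : ℝ} (ha : 1 ≤ a) (hab : a ≤ b) :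
    ContinuousOn (fun u : ℝ => Complex.exp (Complex.I * (lam * Real.exp (-(A * u ^ β)) : ℝ)))
      (Set.uIcc a b) := by
  refine Complex.continuous_exp.comp_continuousOn (continuousOn_const.mul
    (Complex.continuous_ofReal.comp_continuousOn (continuousOn_const.mul
      (Real.continuous_exp.comp_continuousOn (continuousOn_const.mul ?_).neg))))
  refine continuousOn_id.rpow_const fun u hu => Or.inl ?_
  rw [Set.uIcc_of_le hab] at hu
  exact (by linarith [hu.1] : (0 : ℝ) < u).ne'

/-- The part of the integral on which the phase is small. -/
theorem norm_integral_cexp_sub_one_le {A β lam U E : ℝ} (hA : 1 ≤ A) (hβ : 1 < β) (hU : 1 ≤ U)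
    (hlam : lam = Real.exp (A * U ^ β)) (hE : U ≤ E) :
    ‖∫ u in U..E, (Complex.exp (Complex.I * (lam * Real.exp (-(A * u ^ β)) : ℝ)) - 1)‖ ≤ 1 := by
  have hle : ‖∫ u in U..E, (Complex.exp (Complex.I * (lam * Real.exp (-(A * u ^ β)) : ℝ)) - 1)‖ ≤
      ∫ u in U..E, Real.exp (U - u) := by
    refine intervalIntegral.norm_integral_le_of_norm_le hE (ae_of_all _ fun u hu => ?_)
      (Continuous.intervalIntegrable (by fun_prop) _ _)
    refine Real.norm_exp_I_mul_ofReal_sub_one_le.trans ?_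
    rw [hlam, ← Real.exp_add, Real.norm_of_nonneg (Real.exp_pos _).le]
    refine Real.exp_le_exp.2 ?_
    linarith [sub_le_mul_rpow_sub hA hβ hU hu.1.le]
  refine hle.trans ?_
  rw [intervalIntegral.integral_comp_sub_left (fun x => Real.exp x), integral_exp, sub_self,
    Real.exp_zero]
  linarith [Real.exp_pos (U - E)]

/-- The part of the integral on which the phase oscillates. -/
theorem norm_integral_cexp_le {A β lam U : ℝ} (hA : 1 ≤ A) (hβ : 1 < β) (hU : 1 ≤ U)
    (hlam : lam = Real.exp (A * U ^ β)) :
    ‖∫ u in (1)..U, Complex.exp (Complex.I * (lam * Real.exp (-(A * u ^ β)) : ℝ))‖ ≤ 2 := by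
  have hlam0 : 0 < lam := by rw [hlam]; exact Real.exp_pos _
  have hA0 : 0 < A := by linarith
  have hβ0 : 0 < β := by linarith
  have hpos : ∀ u ∈ Set.uIcc 1 U, 0 < u := fun u hu => by
    rw [Set.uIcc_of_le hU] at hu; linarith [hu.1]
  have hdA : ∀ u, 0 < u → HasDerivAt (fun u : ℝ => A * u ^ β) (A * (β * u ^ (β - 1))) u :=
    fun u hu => (Real.hasDerivAt_rpow_const (Or.inl hu.ne')).const_mul A
  -- On `u > 0` this is `-1/Φ'`, the weight for integration by parts.
  set H : ℝ → ℝ := fun u => Real.exp (A * u ^ β) * u ^ (1 - β) / (lam * A * β) with hH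
  set H' : ℝ → ℝ := fun u =>
    Real.exp (A * u ^ β) / lam * (1 - (β - 1) / (A * β) * u ^ (-β)) with hH'
  have hHd : ∀ u, 0 < u → HasDerivAt H (H' u) u := fun u hu => by
    have h1 := (((hdA u hu).exp).mul (Real.hasDerivAt_rpow_const (p := 1 - β)
      (Or.inl hu.ne'))).div_const (lam * A * β)
    refine h1.congr_deriv ?_
    have e1 : u ^ (1 - β) = u / u ^ β := by rw [Real.rpow_sub hu, Real.rpow_one]
    have e2 : u ^ (β - 1) = u ^ β / u := Real.rpow_sub_one hu.ne' β
    have e3 : u ^ (1 - β - 1) = (u ^ β)⁻¹ := by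
      rw [← Real.rpow_neg hu.le]; ring_nf
    have h0 : 0 < u ^ β := by positivity
    simp only [hH', e1, e2, e3, Real.rpow_neg hu.le]
    field_simp
    ring
  -- Monotonicity makes the variation telescope: boundary terms and variation add up to `2 H(U) ≤
  -- 2`.
  have hH'0 : ∀ u ∈ Set.Icc 1 U, 0 ≤ H' u := fun u hu => by
    have h1 : u ^ (-β) ≤ 1 := Real.rpow_le_one_of_one_le_of_nonpos hu.1 (by linarith)
    have h2 : (β - 1) / (A * β) ≤ 1 := by
      rw [div_le_one (by positivity)]; nlinarith
    have h3 : 0 ≤ u ^ (-β) := Real.rpow_nonneg (by linarith [hu.1]) _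
    have h4 : 0 ≤ (β - 1) / (A * β) := div_nonneg (by linarith) (by positivity)
    have h5 : (β - 1) / (A * β) * u ^ (-β) ≤ 1 := mul_le_one₀ h2 h3 h1
    exact mul_nonneg (by positivity) (by linarith)
  have hpowc : ∀ p : ℝ, ContinuousOn (fun u : ℝ => u ^ p) (Set.uIcc 1 U) := fun p =>
    continuousOn_id.rpow_const fun u hu => Or.inl (hpos u hu).ne'
  have hH'c : ContinuousOn H' (Set.uIcc 1 U) :=
    ((Real.continuous_exp.comp_continuousOn (continuousOn_const.mul (hpowc β))).div_const _).mul
      (continuousOn_const.sub (continuousOn_const.mul (hpowc (-β))))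
  set Φ : ℝ → ℝ := fun u => lam * Real.exp (-(A * u ^ β)) with hΦ
  set Φ' : ℝ → ℝ := fun u => lam * (Real.exp (-(A * u ^ β)) * -(A * (β * u ^ (β - 1)))) with hΦ'
  have hΦd : ∀ u, 0 < u → HasDerivAt Φ (Φ' u) u := fun u hu =>
    ((hdA u hu).neg.exp).const_mul lam
  have hΦ'c : ContinuousOn Φ' (Set.uIcc 1 U) :=
    continuousOn_const.mul ((Real.continuous_exp.comp_continuousOn
      (continuousOn_const.mul (hpowc β)).neg).mul
        (continuousOn_const.mul (continuousOn_const.mul (hpowc (β - 1)))).neg)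
  set V : ℝ → ℂ := fun u => Complex.exp (Complex.I * (Φ u : ℝ)) with hV
  have hVd : ∀ u, 0 < u → HasDerivAt V (V u * (Complex.I * (Φ' u : ℝ))) u := fun u hu =>
    (((hΦd u hu).ofReal_comp).const_mul Complex.I).cexp
  have hVc : ContinuousOn V (Set.uIcc 1 U) := continuousOn_cexp_phase A β lam le_rfl hU
  have hVn : ∀ u, ‖V u‖ = 1 := fun u => norm_cexp_I_mul _
  have hHΦ : ∀ u, 0 < u → H u * Φ' u = -1 := fun u hu => by
    have e1 : u ^ (1 - β) = u / u ^ β := by rw [Real.rpow_sub hu, Real.rpow_one]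
    have e2 : u ^ (β - 1) = u ^ β / u := Real.rpow_sub_one hu.ne' β
    have h0 : 0 < u ^ β := by positivity
    simp only [hH, hΦ', e1, e2, Real.exp_neg]
    have := Real.exp_pos (A * u ^ β)
    field_simp
  have hparts := intervalIntegral.integral_mul_deriv_eq_deriv_mul
    (fun u hu => (hHd u (hpos u hu)).ofReal_comp) (fun u hu => hVd u (hpos u hu))
    (Complex.continuous_ofReal.comp_continuousOn hH'c).intervalIntegrable
    (hVc.mul (continuousOn_const.mul
      (Complex.continuous_ofReal.comp_continuousOn hΦ'c))).intervalIntegrable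
  have hint : ∫ u in (1)..U, V u =
      Complex.I * ∫ u in (1)..U, (H u : ℂ) * (V u * (Complex.I * (Φ' u : ℝ))) := by
    rw [← intervalIntegral.integral_const_mul]
    refine intervalIntegral.integral_congr fun u hu => ?_
    have h1 : (H u : ℂ) * (Φ' u : ℂ) = -1 := by exact_mod_cast hHΦ u (hpos u hu)
    linear_combination (-V u * Complex.I ^ 2) * h1 + V u * Complex.I_sq
  have hvar : ‖∫ u in (1)..U, (H' u : ℂ) * V u‖ ≤ H U - H 1 := by
    rw [← intervalIntegral.integral_eq_sub_of_hasDerivAt (fun u hu => hHd u (hpos u hu))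
      hH'c.intervalIntegrable]
    refine intervalIntegral.norm_integral_le_of_norm_le hU (ae_of_all _ fun u hu => ?_)
      hH'c.intervalIntegrable
    rw [norm_mul, hVn, mul_one, Complex.norm_real,
      Real.norm_of_nonneg (hH'0 u (Set.Ioc_subset_Icc_self hu))]
  have hHpos : ∀ u, 0 < u → 0 ≤ H u := fun u hu => by positivity
  have hb : ∀ u, 0 < u → ‖(H u : ℂ) * V u‖ = H u := fun u hu => by
    rw [norm_mul, hVn, mul_one, Complex.norm_real, Real.norm_of_nonneg (hHpos u hu)]
  have hHU : H U ≤ 1 := by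
    have h1 : U ^ (1 - β) ≤ 1 := Real.rpow_le_one_of_one_le_of_nonpos hU (by linarith)
    have h2 : 1 ≤ A * β := by nlinarith
    simp only [hH]
    rw [← hlam, div_le_one (by positivity), mul_assoc]
    exact mul_le_mul_of_nonneg_left (h1.trans h2) hlam0.le
  change ‖∫ u in (1)..U, V u‖ ≤ 2
  rw [hint, norm_mul, Complex.norm_I, one_mul, hparts]
  refine (norm_sub_le _ _).trans ((add_le_add (norm_sub_le _ _) hvar).trans ?_)
  rw [hb U (by linarith), hb 1 one_pos]
  linarith

/-- The main term `1 - U` is the integral of `-1` over `[1, U]`; the oscillating part costs 2 and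
the tail 1, uniformly in `ε`. -/
theorem norm_truncated_flatPhase_add_le {A β b lam U : ℝ} (hA : 1 ≤ A) (hβ : 1 < β) (hU : 1 ≤ U)
    (hlam : lam = Real.exp (A * U ^ β))
    (hcont : ContinuousOn (flatPhase A β b) (Set.Icc (-Real.exp (b - 1)) (Real.exp (b - 1))))
    {ε : ℝ} (hε : 0 < ε) (hεU : ε ≤ Real.exp (b - U)) :
    ‖truncated (Real.exp (b - 1)) (flatPhase A β b) lam ε - ((1 - U : ℝ) : ℂ)‖ ≤ 3 := by
  have hE : U ≤ b - Real.log ε := by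
    have := (Real.log_le_iff_le_exp hε).2 hεU
    linarith
  have c1 := continuousOn_cexp_phase A β lam le_rfl hU
  have c2 := continuousOn_cexp_phase A β lam hU hE
  have i1 : IntervalIntegrable (fun u : ℝ =>
      Complex.exp (Complex.I * (lam * Real.exp (-(A * u ^ β)) : ℝ)) - 1) volume 1 U :=
    (c1.sub continuousOn_const).intervalIntegrable
  have i2 : IntervalIntegrable (fun u : ℝ =>
      Complex.exp (Complex.I * (lam * Real.exp (-(A * u ^ β)) : ℝ)) - 1) volume U
        (b - Real.log ε) := (c2.sub continuousOn_const).intervalIntegrable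
  rw [truncated_flatPhase_eq hcont lam hε (hεU.trans (Real.exp_le_exp.2 (by linarith))),
    ← intervalIntegral.integral_add_adjacent_intervals i1 i2,
    intervalIntegral.integral_sub c1.intervalIntegrable (by simp)]
  have e : (∫ _ in (1 : ℝ)..U, (1 : ℂ)) = ((U - 1 : ℝ) : ℂ) := by simp
  rw [e]
  have h1 := norm_integral_cexp_le hA hβ hU hlam
  have h2 := norm_integral_cexp_sub_one_le hA hβ hU hlam hE
  refine le_trans (le_of_eq ?_) ((norm_add_le _ _).trans (add_le_add h1 h2) |>.trans (by norm_num))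
  congr 1
  push_cast
  ring

theorem attainsGrowth_flatPhase {α β A b : ℝ} (hαβ : α.HolderConjugate β) (hA : 1 ≤ A)
    {M : ℕ → ℝ} (h : MemDenjoyCarleman M (Real.exp (b - 1)) (flatPhase A β b)) :
    AttainsGrowth α (Real.exp (b - 1)) (flatPhase A β b) := by
  have hβ := hαβ.symm.lt
  have hβ0 : 0 < β := by linarith
  have hA0 : 0 < A := by linarith
  have hexp : 1 - 1 / α = 1 / β := by
    have := hαβ.inv_add_inv_eq_one
    rw [one_div, one_div]; linarith
  refine ⟨fun n => Real.exp n, Real.tendsto_exp_atTop.comp tendsto_natCast_atTop_atTop, ?_⟩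
  simp only [Real.log_exp, hexp]
  -- The solution of `A U^β = n`, so that `λ = e^n` has the form required by the two estimates
  -- around `U`.
  set U : ℕ → ℝ := fun n => (A ^ (1 / β))⁻¹ * (n : ℝ) ^ (1 / β) with hU
  have hUtop : Tendsto U atTop atTop := by
    refine Tendsto.const_mul_atTop (by positivity) ?_
    exact (tendsto_rpow_atTop (by positivity)).comp tendsto_natCast_atTop_atTop
  have hUpow : ∀ n : ℕ, A * U n ^ β = n := fun n => by
    simp only [hU]
    rw [Real.mul_rpow (by positivity) (by positivity), Real.inv_rpow (by positivity),
      ← Real.rpow_mul hA0.le, ← Real.rpow_mul (by positivity), one_div_mul_cancel hβ0.ne',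
      Real.rpow_one, Real.rpow_one, mul_inv_cancel_left₀ hA0.ne']
  have hclose : ∀ᶠ n : ℕ in atTop,
      |‖m (Real.exp (b - 1)) (flatPhase A β b) (Real.exp n)‖ - U n| ≤ 4 := by
    filter_upwards [hUtop.eventually_ge_atTop 1] with n hn
    have h1 := (h.hasPV (Real.exp_pos _) (Real.exp n)).norm_sub_le (Real.exp_pos (b - U n))
      fun ε hε hεU => norm_truncated_flatPhase_add_le hA hβ hn (by rw [hUpow]) h.1.continuousOn
        hε hεU
    have h2 := abs_norm_sub_norm_le (m (Real.exp (b - 1)) (flatPhase A β b) (Real.exp n))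
      ((1 - U n : ℝ) : ℂ)
    rw [Complex.norm_real, Real.norm_eq_abs, abs_of_nonpos (by linarith : 1 - U n ≤ 0)] at h2
    have h3 := abs_le.1 (h2.trans h1)
    rw [abs_le]
    constructor <;> linarith
  have hequiv : (fun n : ℕ => ‖m (Real.exp (b - 1)) (flatPhase A β b) (Real.exp n)‖) ~[atTop] U := by
    refine IsBigO.trans_isLittleO (g := fun _ => (1 : ℝ)) (IsBigO.of_bound 4 ?_) ?_
    · filter_upwards [hclose] with n hn
      simpa using hn
    · refine (isLittleO_const_left).2 (Or.inr ?_)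
      exact tendsto_norm_atTop_atTop.comp hUtop
  refine hequiv.isTheta.trans ?_
  have hne : (A ^ (1 / β))⁻¹ ≠ 0 := by positivity
  exact (isTheta_refl _ _).const_mul_left hne

/-! ### Choice of parameters for the two extremal phases -/

theorem sharpPhase_eq_flatPhase (α : ℝ) : sharpPhase α = flatPhase 1 (α / (α - 1)) 0 := by
  ext t
  simp only [sharpPhase, flatPhase, one_div, Real.log_inv, one_mul, zero_sub]

theorem holderConjugate_div_sub_one {α : ℝ} (hα : 1 < α) : α.HolderConjugate (α / (α - 1)) := by
  rw [Real.holderConjugate_iff]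
  have : α - 1 ≠ 0 := by linarith
  have : α ≠ 0 := by linarith
  refine ⟨hα, ?_⟩
  field_simp
  ring

/-- For every `c > 0` some flat phase on `[-1, 1]` lies in the class with weight `exp(c n^α)`. -/
theorem exists_flatPhase_mem {α c : ℝ} (hα : 1 < α) (hc : 0 < c) :
    ∃ A : ℝ, 1 ≤ A ∧ MemDenjoyCarleman (weight c α) 1 (flatPhase A (α / (α - 1)) 1) := by
  have hαβ := holderConjugate_div_sub_one hα
  set β := α / (α - 1)
  have hα0 : 0 < α := by linarith
  have hβ0 : 0 < β := hαβ.symm.pos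
  -- Here `c` is prescribed: `τ` solves `τ^{-α}/α = c/2`, and `A` is then taken large enough for
  -- `τ^β/β ≤ A/2`.
  set τ : ℝ := (α * (c / 2)) ^ (-(1 / α)) with hτ
  have hτ0 : 0 < τ := by positivity
  have hτc : τ ^ (-α) / α ≤ c / 2 := by
    rw [hτ, ← Real.rpow_mul (by positivity), neg_mul_neg, one_div_mul_cancel hα0.ne',
      Real.rpow_one, mul_div_cancel_left₀ _ hα0.ne']
  refine ⟨max 1 (2 * (τ ^ β / β)), le_max_left _ _, ?_⟩
  have hA0 : 0 < max 1 (2 * (τ ^ β / β)) := lt_of_lt_of_le one_pos (le_max_left _ _)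
  have := memDenjoyCarleman_flatPhase (b := 1) hαβ hA0 hτ0
    (by linarith [le_max_right 1 (2 * (τ ^ β / β))]) hc hτc
  rwa [sub_self, Real.exp_zero] at this

theorem exists_weight_sharpPhase_mem {α : ℝ} (hα : 1 < α) :
    ∃ c : ℝ, 0 < c ∧ MemDenjoyCarleman (weight c α) (Real.exp (-1)) (sharpPhase α) := by
  have hαβ := holderConjugate_div_sub_one hα
  rw [sharpPhase_eq_flatPhase]
  set β := α / (α - 1)
  have hα0 : 0 < α := by linarith
  have hβ0 : 0 < β := hαβ.symm.pos
  -- Here `A = 1` is prescribed: `τ` solves `τ^β/β = 1/2`, and `c` is read off from `τ`.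
  set τ : ℝ := (β * (1 / 2)) ^ (1 / β) with hτ
  have hτ0 : 0 < τ := by positivity
  have hτA : τ ^ β / β ≤ 1 / 2 := by
    rw [hτ, ← Real.rpow_mul (by positivity), one_div_mul_cancel hβ0.ne',
      Real.rpow_one, mul_div_cancel_left₀ _ hβ0.ne']
  refine ⟨2 * (τ ^ (-α) / α), by positivity, ?_⟩
  have := memDenjoyCarleman_flatPhase (b := 0) (c := 2 * (τ ^ (-α) / α)) hαβ one_pos hτ0 hτA
    (by positivity) (by linarith)
  rwa [zero_sub] at this

end SteinWainger

end

theorem theorem7p1 (α : ℝ) (hα : 1 < α) :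
    (∀ c : ℝ, 0 < c →
      (∀ ψ : ℝ → ℝ, SteinWainger.MemDenjoyCarleman (SteinWainger.weight c α) 1 ψ →
        (∀ lam : ℝ, SteinWainger.HasPV 1 ψ lam (SteinWainger.m 1 ψ lam)) ∧
        (fun lam : ℝ => SteinWainger.m 1 ψ lam) =O[atTop]
          (fun lam : ℝ => (Real.log lam) ^ (1 - 1 / α))) ∧
      (∃ ψ : ℝ → ℝ, SteinWainger.MemDenjoyCarleman (SteinWainger.weight c α) 1 ψ ∧
        SteinWainger.AttainsGrowth α 1 ψ)) ∧
    (∃ c : ℝ, 0 < c ∧ SteinWainger.MemDenjoyCarleman (SteinWainger.weight c α)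
      (Real.exp (-1)) (SteinWainger.sharpPhase α)) ∧
    (∀ lam : ℝ, SteinWainger.HasPV (Real.exp (-1)) (SteinWainger.sharpPhase α) lam
      (SteinWainger.m (Real.exp (-1)) (SteinWainger.sharpPhase α) lam)) ∧
    SteinWainger.AttainsGrowth α (Real.exp (-1)) (SteinWainger.sharpPhase α) := by
  have hαβ := SteinWainger.holderConjugate_div_sub_one hα
  refine ⟨fun c hc => ⟨fun ψ hψ => ⟨hψ.hasPV one_pos,
    SteinWainger.isBigO_m_of_memDenjoyCarleman hα hc hψ⟩, ?_⟩,
    SteinWainger.exists_weight_sharpPhase_mem hα, ?_, ?_⟩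
  · obtain ⟨A, hA, hmem⟩ := SteinWainger.exists_flatPhase_mem hα hc
    refine ⟨_, hmem, ?_⟩
    -- The radius is `e^{b-1}`: `b = 1` gives `[-1, 1]`, and `b = 0` below gives `[-1/e, 1/e]`.
    have e : Real.exp (1 - 1) = 1 := by rw [sub_self, Real.exp_zero]
    have := SteinWainger.attainsGrowth_flatPhase (b := 1) hαβ hA (by rwa [e])
    rwa [e] at this
  · obtain ⟨c, -, hmem⟩ := SteinWainger.exists_weight_sharpPhase_mem hα
    exact hmem.hasPV (Real.exp_pos _)
  · obtain ⟨c, -, hmem⟩ := SteinWainger.exists_weight_sharpPhase_mem hα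
    rw [SteinWainger.sharpPhase_eq_flatPhase] at hmem ⊢
    have := SteinWainger.attainsGrowth_flatPhase (b := 0) hαβ le_rfl (by rwa [zero_sub])
    rwa [zero_sub] at this
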